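/- Let $n\ge 5$. A dissection of a convex $n$-gon is a set of pairwise noncrossing diagonals. An associahedron $\mathrm{Assoc}_{n-3}$ is an $(n-3)$-dimensional convex polytope whose nonempty faces (including the polytope itself), ordered by inclusion, form a poset isomorphic to the dissections of the convex $n$-gon ordered by reverse inclusion; so its vertices correspond to the triangulations and its facets to the diagonals of the $n$-gon. Such a polytope exists in $\mathbb{R}^{n-3}$. Moreover, for every such polytope $\mathrm{Assoc}_{n-3}$ in a finite-dimensional real normed space there is an enumeration without repetition $v_1,\dots,v_{C_{n-2}}$ of all its vertices, where $C_m=\frac{1}{m+1}\binom{2m}{m}$, such that, with $v_{C_{n-2}+1}=v_1$, the open segment between $v_i$ and $v_{i+1}$ lies in the interior of $\mathrm{Assoc}_{n-3}$ (relative to its affine hull) for every $i=1,\dots,C_{n-2}$. -/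

import Mathlib

/-- The vertices of the convex `n`-gon are `0, 1, …, n - 1` in cyclic order.  A diagonal `{i, j}`
(two distinct vertices which are not cyclically adjacent) is represented by the pair `(i, j)`
with `i < j`. -/
def IsDiagonal {n : ℕ} (d : Fin n × Fin n) : Prop :=
  (d.1 : ℕ) + 1 < (d.2 : ℕ) ∧ ¬ ((d.1 : ℕ) = 0 ∧ (d.2 : ℕ) + 1 = n)

/-- Two diagonals of a convex polygon cross when they meet in the interior of the polygon, that is,
when their endpoints strictly alternate along the boundary. -/
def Crosses {n : ℕ} (d e : Fin n × Fin n) : Prop :=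
  (d.1 < e.1 ∧ e.1 < d.2 ∧ d.2 < e.2) ∨ (e.1 < d.1 ∧ d.1 < e.2 ∧ e.2 < d.2)

/-- The dissections of the convex `n`-gon: sets of pairwise noncrossing diagonals.  They are ordered
by inclusion; the maximal ones are the triangulations. -/
abbrev Dissection (n : ℕ) : Type :=
  {D : Finset (Fin n × Fin n) //
    (∀ d ∈ D, IsDiagonal d) ∧ ∀ d ∈ D, ∀ e ∈ D, ¬ Crosses d e}

/-- The nonempty faces of a convex set `P` (including `P` itself), ordered by inclusion: the sets of
maximizers over `P` of continuous linear functionals. -/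
abbrev Face {E : Type*} [NormedAddCommGroup E] [NormedSpace ℝ E] (P : Set E) : Type _ :=
  {F : Set E // F.Nonempty ∧ IsExposed ℝ P F}

/-- A convex polytope: the convex hull of finitely many points. -/
def IsPolytope {E : Type*} [NormedAddCommGroup E] [NormedSpace ℝ E] (P : Set E) : Prop :=
  ∃ s : Finset E, P = convexHull ℝ (s : Set E)

/-- `P` is (a realization of) the associahedron of the convex `n`-gon, of dimension `n - 3`:
a polytope of that dimension whose nonempty faces, ordered by inclusion, correspond to the
dissections of the `n`-gon, ordered by reverse inclusion.  Thus its vertices correspond to the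
triangulations and its facets to the diagonals. -/
structure IsAssociahedron {E : Type*} [NormedAddCommGroup E] [NormedSpace ℝ E]
    (n : ℕ) (P : Set E) : Prop where
  isPolytope : IsPolytope P
  finrank_vectorSpan : Module.finrank ℝ (vectorSpan ℝ P) + 3 = n
  faceIso : Nonempty (Face P ≃o (Dissection n)ᵒᵈ)

/-! A segment between two vertices of a polytope runs through the relative interior as soon as no
proper face contains both. A face contains the vertices of `T` and `T'` exactly when its dissection
lies in `T ∩ T'`, so vertices of disjoint triangulations see each other through the interior. It
remains to find a Hamiltonian cycle in the graph whose vertices are the triangulations and whose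
edges are the disjoint pairs. This graph does not depend on the realization.

Rotating the polygon by one step is an automorphism `r` of this graph. Every diagonal crosses its
own rotation, so `T` and `r T` are disjoint and the orbits of `r` are already cycles. They are
joined along flips: if `T'` arises from `T` by a flip, then `T'` is disjoint from `r T` or from `r⁻¹
T` (`IsFlip.disjoint_rot`), and the flip graph is connected. If `x` and `y` in two orbits are
disjoint, so are `r x` and `r y`, and replacing the edges `{x, r x}`, `{y, r y}` by `{x, y}`, `{r x,
r y}` merges two cycles (`MergeState.step`).

Each merge uses up an edge of an orbit, so every orbit should be linked with fewer orbits than it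
has elements. For this, a flip at `d` is labelled by the apex of the triangle on the shorter side of
`d`. A vertex labels at most one diagonal (`IsShortApex.unique_zero`) and some vertex labels none
(`IsTriangulation.exists_not_isShortApex`). After rotating labels to the vertex 0, the elements of
an orbit enumerate its linked orbits, with at least one element left over (`orbitDegree_lt`).

The length of the cycle is computed by a bijection with binary trees. Existence is Loday's
realization, with one inequality per diagonal: the identity `slack_exchange` prevents crossing
diagonals from being tight together, and the slacks on a triangulation can be prescribed freely. -/

/-! ### Triangulations, their triangles, and the connectedness of the flip graph. -/

/-- A diagonal of the `n`-gon, as a pair of natural numbers. -/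
def NatDiagonal (n : ℕ) (d : ℕ × ℕ) : Prop :=
  d.1 + 1 < d.2 ∧ d.2 < n ∧ ¬ (d.1 = 0 ∧ d.2 + 1 = n)

/-- The crossing relation for pairs of natural numbers. -/
def NatCrosses (d e : ℕ × ℕ) : Prop :=
  (d.1 < e.1 ∧ e.1 < d.2 ∧ d.2 < e.2) ∨ (e.1 < d.1 ∧ d.1 < e.2 ∧ e.2 < d.2)

/-- Dissections of the `n`-gon, with vertices as natural numbers. -/
def IsDissection (n : ℕ) (D : Finset (ℕ × ℕ)) : Prop :=
  (∀ d ∈ D, NatDiagonal n d) ∧ ∀ d ∈ D, ∀ e ∈ D, ¬ NatCrosses d e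

/-- Triangulations of the `n`-gon: the maximal dissections. -/
def IsTriangulation (n : ℕ) (T : Finset (ℕ × ℕ)) : Prop :=
  IsDissection n T ∧ ∀ e, NatDiagonal n e → (∀ d ∈ T, ¬ NatCrosses d e) → e ∈ T

/-- The chords of a dissection: its diagonals together with the sides of the polygon. -/
def IsChord (n : ℕ) (T : Finset (ℕ × ℕ)) (i j : ℕ) : Prop :=
  (i, j) ∈ T ∨ (j = i + 1 ∧ j < n) ∨ (i = 0 ∧ 0 < j ∧ j + 1 = n)

theorem IsDissection.isChord_lt {n : ℕ} {T : Finset (ℕ × ℕ)} (hT : IsDissection n T) {i j : ℕ}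
    (h : IsChord n T i j) : i < j ∧ j < n := by
  rcases h with h | h | h
  · have := hT.1 _ h
    simp only [NatDiagonal] at this
    omega
  · omega
  · omega

theorem IsDissection.isChord_noncrossing {n : ℕ} {T : Finset (ℕ × ℕ)} (hT : IsDissection n T)
    {i j p q : ℕ} (h : IsChord n T i j) (h' : IsChord n T p q) : ¬ (i < p ∧ p < j ∧ j < q) := by
  have h1 := hT.isChord_lt h
  have h2 := hT.isChord_lt h'
  rcases h with h | h | h
  · rcases h' with h' | h' | h'
    · have := hT.2 _ h _ h'
      simp only [NatCrosses] at this
      omega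
    · omega
    · omega
  · omega
  · omega

theorem IsDissection.mem_of_isChord {n : ℕ} {T : Finset (ℕ × ℕ)} {i j : ℕ}
    (h : IsChord n T i j) (hij : i + 1 < j) (hn : ¬ (i = 0 ∧ j + 1 = n)) : (i, j) ∈ T := by
  rcases h with h | h | h
  · exact h
  · omega
  · omega

theorem IsTriangulation.isChord_of_noncrossing {n : ℕ} {T : Finset (ℕ × ℕ)}
    (hT : IsTriangulation n T) {i j : ℕ} (hij : i < j) (hj : j < n)
    (h : ∀ p q, (p, q) ∈ T → ¬ (p < i ∧ i < q ∧ q < j) ∧ ¬ (i < p ∧ p < j ∧ j < q)) :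
    IsChord n T i j := by
  by_cases h1 : j = i + 1
  · exact Or.inr (Or.inl ⟨h1, hj⟩)
  by_cases h2 : i = 0 ∧ j + 1 = n
  · exact Or.inr (Or.inr ⟨h2.1, by omega, h2.2⟩)
  refine Or.inl (hT.2 (i, j) ⟨by simp only; omega, hj, h2⟩ ?_)
  rintro ⟨p, q⟩ hpq
  have := h p q hpq
  simp only [NatCrosses]
  omega

/-- Every chord which is not a short side is the long side of a triangle. -/
theorem IsTriangulation.exists_apex {n : ℕ} {T : Finset (ℕ × ℕ)} (hT : IsTriangulation n T)
    {i j : ℕ} (h : IsChord n T i j) (hij : i + 1 < j) :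
    ∃ m, i < m ∧ m < j ∧ IsChord n T i m ∧ IsChord n T m j := by
  classical
  have hlt := hT.1.isChord_lt h
  have hne : ((Finset.range j).filter fun m => IsChord n T i m).Nonempty :=
    ⟨i + 1, by simp only [Finset.mem_filter, Finset.mem_range]; exact ⟨hij, Or.inr (Or.inl ⟨rfl, by omega⟩)⟩⟩
  obtain ⟨m, hm, hmax⟩ := Finset.exists_max_image _ id hne
  simp only [Finset.mem_filter, Finset.mem_range, id] at hm hmax
  have him := hT.1.isChord_lt hm.2
  refine ⟨m, him.1, hm.1, hm.2, hT.isChord_of_noncrossing hm.1 hlt.2 ?_⟩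
  intro p q hpq
  have hc : IsChord n T p q := Or.inl hpq
  have h1 := hT.1.isChord_noncrossing hm.2 hc
  have h2 := hT.1.isChord_noncrossing h hc
  have h3 := hT.1.isChord_noncrossing hc h
  constructor
  · rintro ⟨a1, a2, a3⟩
    rcases lt_trichotomy p i with hp | hp | hp
    · omega
    · subst hp
      have := hmax q ⟨a3, hc⟩
      omega
    · omega
  · omega

/-- Every diagonal of a triangulation is a side of a triangle lying outside of it. -/
theorem IsTriangulation.exists_outer_apex {n : ℕ} {T : Finset (ℕ × ℕ)} (hT : IsTriangulation n T)
    {a b : ℕ} (h : (a, b) ∈ T) :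
    (∃ m, m < a ∧ IsChord n T m a ∧ IsChord n T m b) ∨
      ∃ m, b < m ∧ IsChord n T a m ∧ IsChord n T b m := by
  classical
  have hd := hT.1.1 _ h
  simp only [NatDiagonal] at hd
  have hab : IsChord n T a b := Or.inl h
  have hne : (((Finset.range n) ×ˢ (Finset.range n)).filter fun c =>
      IsChord n T c.1 c.2 ∧ c.1 ≤ a ∧ b ≤ c.2 ∧ c ≠ (a, b)).Nonempty := by
    refine ⟨(0, n - 1), ?_⟩
    simp only [Finset.mem_filter, Finset.mem_product, Finset.mem_range, ne_eq, Prod.mk.injEq]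
    refine ⟨by omega, Or.inr (Or.inr (by omega)), by omega, by omega, by omega⟩
  -- The shortest chord properly enclosing `(a, b)` is the long side of the outer triangle: its apex
  -- cannot lie strictly between `a` and `b`, and minimality makes one of the short sides equal to
  -- `(a, b)`.
  obtain ⟨⟨p, q⟩, hm, hmin⟩ := Finset.exists_min_image _ (fun c => c.2 - c.1) hne
  simp only [Finset.mem_filter, Finset.mem_product, Finset.mem_range, ne_eq, Prod.mk.injEq,
    Prod.forall] at hm hmin
  obtain ⟨m, h1, h2, h3, h4⟩ := hT.exists_apex hm.2.1 (by omega)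
  have c1 := hT.1.isChord_noncrossing h3 hab
  have c2 := hT.1.isChord_noncrossing hab h4
  rcases le_or_gt m a with hma | hma
  · have := hmin m q
    by_cases he : m = a ∧ q = b
    · obtain ⟨rfl, rfl⟩ := he
      exact Or.inl ⟨p, h1, h3, hm.2.1⟩
    · have := hmin m q ⟨by omega, h4, hma, hm.2.2.2.1, he⟩
      omega
  · have hbm : b ≤ m := by omega
    by_cases he : p = a ∧ m = b
    · obtain ⟨rfl, rfl⟩ := he
      exact Or.inr ⟨q, h2, hm.2.1, h4⟩
    · have := hmin p m ⟨by omega, h3, hm.2.2.1, hbm, he⟩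
      omega

/-- `T'` arises from `T` by exchanging the diagonal `d` for the diagonal `d'`. -/
def IsFlip (T T' : Finset (ℕ × ℕ)) (d d' : ℕ × ℕ) : Prop :=
  d ∈ T ∧ d' ∈ T' ∧ d ≠ d' ∧ T.erase d = T'.erase d'

theorem IsFlip.symm {T T' : Finset (ℕ × ℕ)} {d d' : ℕ × ℕ} (h : IsFlip T T' d d') :
    IsFlip T' T d' d := ⟨h.2.1, h.1, h.2.2.1.symm, h.2.2.2.symm⟩

theorem IsFlip.mem_of_mem {T T' : Finset (ℕ × ℕ)} {d d' e : ℕ × ℕ} (h : IsFlip T T' d d')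
    (he : e ∈ T) (hed : e ≠ d) : e ∈ T' := by
  have : e ∈ T.erase d := Finset.mem_erase.2 ⟨hed, he⟩
  rw [h.2.2.2] at this
  exact (Finset.mem_erase.1 this).2

theorem IsFlip.notMem {T T' : Finset (ℕ × ℕ)} {d d' : ℕ × ℕ} (h : IsFlip T T' d d') :
    d' ∉ T := by
  intro h'
  have : d' ∈ T.erase d := Finset.mem_erase.2 ⟨h.2.2.1.symm, h'⟩
  rw [h.2.2.2] at this
  exact (Finset.mem_erase.1 this).1 rfl

theorem IsFlip.isChord {n : ℕ} {T T' : Finset (ℕ × ℕ)} {d d' : ℕ × ℕ} (h : IsFlip T T' d d')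
    {i j : ℕ} (hc : IsChord n T i j) (hd : (i, j) ≠ d) : IsChord n T' i j := by
  rcases hc with hc | hc | hc
  · exact Or.inl (h.mem_of_mem hc hd)
  · exact Or.inr (Or.inl hc)
  · exact Or.inr (Or.inr hc)

/-- Otherwise `d'` would cross nothing in `T`, because the other diagonals of `T` survive in `T'`,
and maximality would put `d'` into `T`. -/
theorem IsFlip.crosses {n : ℕ} {T T' : Finset (ℕ × ℕ)} {d d' : ℕ × ℕ} (h : IsFlip T T' d d')
    (hT : IsTriangulation n T) (hT' : IsTriangulation n T') : NatCrosses d d' := by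
  by_contra hc
  refine h.notMem (hT.2 d' (hT'.1.1 _ h.2.1) fun e he => ?_)
  by_cases hed : e = d
  · rwa [hed]
  · exact hT'.1.2 _ (h.mem_of_mem he hed) _ h.2.1

/-- The exchanged diagonal is determined by the triangulation and the removed diagonal. -/
theorem IsTriangulation.exists_flip_diagonal {n : ℕ} {T : Finset (ℕ × ℕ)}
    (hT : IsTriangulation n T) {d : ℕ × ℕ} (hd : d ∈ T) :
    ∃ e, ∀ T' d', IsTriangulation n T' → IsFlip T T' d d' → d' = e := by
  obtain ⟨a, b⟩ := d
  have hdd := hT.1.1 _ hd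
  simp only [NatDiagonal] at hdd
  obtain ⟨m, h1, h2, h3, h4⟩ := hT.exists_apex (Or.inl hd) hdd.1
  -- The four other sides of the two triangles at `(a, b)` survive the flip. A diagonal that crosses
  -- `(a, b)` but none of them must join the two apices.
  have key : ∀ T' d', IsTriangulation n T' → IsFlip T T' (a, b) d' → ∀ i j, IsChord n T i j →
      (i, j) ≠ (a, b) → ¬ (i < d'.1 ∧ d'.1 < j ∧ j < d'.2) ∧ ¬ (d'.1 < i ∧ i < d'.2 ∧ d'.2 < j) := by
    intro T' d' hT' hf i j hij hne
    have := hf.isChord hij hne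
    exact ⟨hT'.1.isChord_noncrossing this (Or.inl hf.2.1),
      hT'.1.isChord_noncrossing (Or.inl hf.2.1) this⟩
  rcases hT.exists_outer_apex hd with ⟨k, hk, h5, h6⟩ | ⟨k, hk, h5, h6⟩
  · refine ⟨(k, m), fun T' d' hT' hf => ?_⟩
    have c := hf.crosses hT hT'
    have k1 := key T' d' hT' hf _ _ h3 (by simp; omega)
    have k2 := key T' d' hT' hf _ _ h4 (by simp; omega)
    have k3 := key T' d' hT' hf _ _ h5 (by simp; omega)
    have k4 := key T' d' hT' hf _ _ h6 (by simp; omega)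
    simp only [NatCrosses] at c
    ext <;> simp only <;> omega
  · refine ⟨(m, k), fun T' d' hT' hf => ?_⟩
    have c := hf.crosses hT hT'
    have k1 := key T' d' hT' hf _ _ h3 (by simp; omega)
    have k2 := key T' d' hT' hf _ _ h4 (by simp; omega)
    have k3 := key T' d' hT' hf _ _ h5 (by simp; omega)
    have k4 := key T' d' hT' hf _ _ h6 (by simp; omega)
    simp only [NatCrosses] at c
    ext <;> simp only <;> omega

theorem IsFlip.unique {n : ℕ} {T T' T'' : Finset (ℕ × ℕ)} {d d' d'' : ℕ × ℕ}
    (hT : IsTriangulation n T) (hT' : IsTriangulation n T') (hT'' : IsTriangulation n T'')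
    (h' : IsFlip T T' d d') (h'' : IsFlip T T'' d d'') : T' = T'' := by
  obtain ⟨e, he⟩ := hT.exists_flip_diagonal h'.1
  have e1 := he _ _ hT' h'
  have e2 := he _ _ hT'' h''
  rw [← Finset.insert_erase h'.2.1, ← Finset.insert_erase h''.2.1, ← h'.2.2.2, ← h''.2.2.2, e1, e2]

/-- The two triangulations arise from one another by exchanging one diagonal. -/
def FlipAdj (n : ℕ) (T T' : Finset (ℕ × ℕ)) : Prop :=
  IsTriangulation n T ∧ IsTriangulation n T' ∧ ∃ d d', IsFlip T T' d d'

/-- A longest diagonal avoiding the vertex 0 has 0 as its outer apex, since another apex would give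
a longer diagonal avoiding 0. Flipping it produces a diagonal at 0. -/
theorem IsTriangulation.exists_flip_zero {n : ℕ} {T : Finset (ℕ × ℕ)}
    (hT : IsTriangulation n T) (h : ∃ d ∈ T, d.1 ≠ 0) :
    ∃ T', FlipAdj n T T' ∧ (T'.filter fun d => d.1 ≠ 0).card < (T.filter fun d => d.1 ≠ 0).card := by
  have hne : (T.filter fun d => d.1 ≠ 0).Nonempty := by
    obtain ⟨d, hd, hd0⟩ := h
    exact ⟨d, Finset.mem_filter.2 ⟨hd, hd0⟩⟩
  obtain ⟨⟨a, b⟩, hm, hmax⟩ := Finset.exists_max_image _ (fun c => c.2 - c.1) hne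
  simp only [Finset.mem_filter, Prod.forall, and_imp] at hm hmax
  obtain ⟨hab, ha⟩ := hm
  have hd := hT.1.1 _ hab
  simp only [NatDiagonal] at hd
  obtain ⟨m, h1, h2, h3, h4⟩ := hT.exists_apex (Or.inl hab) hd.1
  have hout : IsChord n T 0 a ∧ IsChord n T 0 b := by
    rcases hT.exists_outer_apex hab with ⟨k, hk, h5, h6⟩ | ⟨k, hk, h5, h6⟩
    · by_cases hk0 : k = 0
      · subst hk0
        exact ⟨h5, h6⟩
      · have := hmax k b (IsDissection.mem_of_isChord h6 (by omega) (by omega)) hk0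
        omega
    · have := hmax a k (IsDissection.mem_of_isChord h5 (by omega) (by omega)) ha
      omega
  have hnc : ∀ p q, IsChord n T p q → (p, q) ≠ (a, b) →
      ¬ NatCrosses (p, q) (0, m) := by
    intro p q hpq hne
    have l := hT.1.isChord_lt hpq
    have k1 := hT.1.isChord_noncrossing hpq h3
    have k2 := hT.1.isChord_noncrossing hpq h4
    have k3 := hT.1.isChord_noncrossing hpq hout.1
    have k4 := hT.1.isChord_noncrossing hpq hout.2
    have k5 := hT.1.isChord_noncrossing h3 hpq
    have k6 := hT.1.isChord_noncrossing h4 hpq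
    have k7 := hT.1.isChord_noncrossing hout.1 hpq
    have k8 := hT.1.isChord_noncrossing hout.2 hpq
    simp only [ne_eq, Prod.mk.injEq] at hne
    simp only [NatCrosses]
    omega
  have h0m : (0, m) ∉ T := fun h => by
    have := hT.1.2 _ h _ hab
    simp only [NatCrosses] at this
    omega
  have hT' : IsTriangulation n (insert (0, m) (T.erase (a, b))) := by
    refine ⟨⟨?_, ?_⟩, ?_⟩
    · intro d hd'
      rcases Finset.mem_insert.1 hd' with rfl | hd'
      · simp only [NatDiagonal]
        omega
      · exact hT.1.1 _ (Finset.mem_of_mem_erase hd')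
    · have aux : ∀ d ∈ T.erase (a, b), ¬ NatCrosses d (0, m) := by
        rintro ⟨p, q⟩ hpq
        exact hnc p q (Or.inl (Finset.mem_of_mem_erase hpq)) (Finset.ne_of_mem_erase hpq)
      intro d hd' e he
      rcases Finset.mem_insert.1 hd' with rfl | hd' <;> rcases Finset.mem_insert.1 he with rfl | he
      · simp [NatCrosses]
      · have := aux e he
        simp only [NatCrosses] at this ⊢
        omega
      · exact aux d hd'
      · exact hT.1.2 _ (Finset.mem_of_mem_erase hd') _ (Finset.mem_of_mem_erase he)
    · rintro ⟨p, q⟩ hpq hc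
      have hc0 := hc (0, m) (Finset.mem_insert_self _ _)
      have hc1 : ∀ i j, IsChord n T i j → (i, j) ≠ (a, b) →
          ¬ (i < p ∧ p < j ∧ j < q) ∧ ¬ (p < i ∧ i < q ∧ q < j) := by
        intro i j hij hne
        rcases hij with hij | hij | hij
        · have := hc (i, j) (Finset.mem_insert_of_mem (Finset.mem_erase.2 ⟨hne, hij⟩))
          simp only [NatCrosses] at this
          omega
        · omega
        · simp only [NatDiagonal] at hpq
          omega
      simp only [NatDiagonal] at hpq
      by_cases hx : NatCrosses (a, b) (p, q)
      · have k1 := hc1 _ _ h3 (by simp; omega)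
        have k2 := hc1 _ _ h4 (by simp; omega)
        have k3 := hc1 _ _ hout.1 (by simp; omega)
        have k4 := hc1 _ _ hout.2 (by simp; omega)
        simp only [NatCrosses] at hx
        have : p = 0 ∧ q = m := by omega
        rw [this.1, this.2]
        exact Finset.mem_insert_self _ _
      · have : (p, q) ∈ T := by
          refine hT.2 _ hpq fun e he => ?_
          by_cases hee : e = (a, b)
          · rwa [hee]
          · exact hc e (Finset.mem_insert_of_mem (Finset.mem_erase.2 ⟨hee, he⟩))
        refine Finset.mem_insert_of_mem (Finset.mem_erase.2 ⟨?_, this⟩)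
        rintro heq
        simp only [Prod.mk.injEq] at heq
        simp only [NatCrosses] at hc0
        omega
  have hne' : (a, b) ≠ (0, m) := by simp [ha]
  have h0m' : (0, m) ∉ T.erase (a, b) := fun h => h0m (Finset.mem_of_mem_erase h)
  refine ⟨_, ⟨hT, hT', (a, b), (0, m), hab, Finset.mem_insert_self _ _, hne', ?_⟩, ?_⟩
  · rw [Finset.erase_insert h0m']
  · apply Finset.card_lt_card
    rw [Finset.ssubset_iff_of_subset]
    · refine ⟨(a, b), Finset.mem_filter.2 ⟨hab, ha⟩, ?_⟩
      simp [hne', ha]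
    · intro e he
      simp only [Finset.mem_filter, Finset.mem_insert, Finset.mem_erase] at he ⊢
      rcases he with ⟨rfl | he, he'⟩
      · exact absurd rfl he'
      · exact ⟨he.2, he'⟩

/-- Diagonals from 0 never cross one another, so by maximality both triangulations are the full fan
at 0. -/
theorem IsTriangulation.eq_of_forall_fst_eq_zero {n : ℕ} {T T' : Finset (ℕ × ℕ)}
    (hT : IsTriangulation n T) (hT' : IsTriangulation n T') (h : ∀ d ∈ T, d.1 = 0)
    (h' : ∀ d ∈ T', d.1 = 0) : T = T' := by
  have aux : ∀ {U V : Finset (ℕ × ℕ)}, IsTriangulation n U → IsTriangulation n V →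
      (∀ d ∈ U, d.1 = 0) → (∀ d ∈ V, d.1 = 0) → U ⊆ V := by
    intro U V hU hV hU0 hV0 d hd
    refine hV.2 d (hU.1.1 d hd) fun e he => ?_
    have := hU0 d hd
    have := hV0 e he
    simp only [NatCrosses]
    omega
  exact (aux hT hT' h h').antisymm (aux hT' hT h' h)

theorem FlipAdj.symm {n : ℕ} {T T' : Finset (ℕ × ℕ)} (h : FlipAdj n T T') : FlipAdj n T' T := by
  obtain ⟨h1, h2, d, d', h3⟩ := h
  exact ⟨h2, h1, d', d, h3.symm⟩

theorem IsTriangulation.exists_flips_to_fan {n : ℕ} {T : Finset (ℕ × ℕ)}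
    (hT : IsTriangulation n T) :
    ∃ T', Relation.ReflTransGen (FlipAdj n) T T' ∧ IsTriangulation n T' ∧ ∀ d ∈ T', d.1 = 0 := by
  induction hk : (T.filter fun d => d.1 ≠ 0).card using Nat.strong_induction_on generalizing T with
  | _ k ih =>
    by_cases h : ∃ d ∈ T, d.1 ≠ 0
    · obtain ⟨T₁, h1, h2⟩ := hT.exists_flip_zero h
      obtain ⟨T', h3, h4⟩ := ih _ (hk ▸ h2) h1.2.1 rfl
      exact ⟨T', Relation.ReflTransGen.head h1 h3, h4⟩
    · push Not at h
      exact ⟨T, Relation.ReflTransGen.refl, hT, h⟩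

/-- The flip graph is connected. -/
theorem IsTriangulation.reflTransGen_flipAdj {n : ℕ} {T T' : Finset (ℕ × ℕ)}
    (hT : IsTriangulation n T) (hT' : IsTriangulation n T') :
    Relation.ReflTransGen (FlipAdj n) T T' := by
  obtain ⟨U, h1, h2, h3⟩ := hT.exists_flips_to_fan
  obtain ⟨V, h4, h5, h6⟩ := hT'.exists_flips_to_fan
  rw [h2.eq_of_forall_fst_eq_zero h5 h3 h6] at h1
  have : Std.Symm (FlipAdj n) := ⟨fun _ _ h => h.symm⟩
  exact h1.trans (Std.Symm.symm _ _ h4)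

/-! ### Rotation, and disjointness of rotated and flipped triangulations. -/

/-- Rotation of the diagonals of the `n`-gon. -/
def rotDiagonal (n : ℕ) (d : ℕ × ℕ) : ℕ × ℕ :=
  if d.2 + 1 < n then (d.1 + 1, d.2 + 1) else (0, d.1 + 1)

/-- The inverse of `rotDiagonal`. -/
def unrotDiagonal (n : ℕ) (d : ℕ × ℕ) : ℕ × ℕ :=
  if d.1 = 0 then (d.2 - 1, n - 1) else (d.1 - 1, d.2 - 1)

theorem NatDiagonal.rot {n : ℕ} {d : ℕ × ℕ} (h : NatDiagonal n d) :
    NatDiagonal n (rotDiagonal n d) := by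
  unfold NatDiagonal rotDiagonal at *
  split_ifs
  · exact ⟨by simp only; omega, by simp only; omega, fun h' => h'.1⟩
  · exact ⟨by simp only; omega, by simp only; omega, fun h' => by simp only at h'; omega⟩

theorem NatDiagonal.unrot {n : ℕ} {d : ℕ × ℕ} (h : NatDiagonal n d) :
    NatDiagonal n (unrotDiagonal n d) := by
  unfold NatDiagonal unrotDiagonal at *
  split_ifs <;> simp only <;> omega

theorem NatDiagonal.unrot_rot {n : ℕ} {d : ℕ × ℕ} (h : NatDiagonal n d) :
    unrotDiagonal n (rotDiagonal n d) = d := by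
  unfold NatDiagonal at h
  unfold unrotDiagonal rotDiagonal
  ext <;> split_ifs <;> simp_all <;> omega

theorem NatDiagonal.rot_unrot {n : ℕ} {d : ℕ × ℕ} (h : NatDiagonal n d) :
    rotDiagonal n (unrotDiagonal n d) = d := by
  unfold NatDiagonal at h
  unfold unrotDiagonal rotDiagonal
  ext <;> split_ifs <;> simp_all <;> omega

theorem NatDiagonal.crosses_rot {n : ℕ} {d e : ℕ × ℕ} (hd : NatDiagonal n d)
    (he : NatDiagonal n e) :
    NatCrosses (rotDiagonal n d) (rotDiagonal n e) ↔ NatCrosses d e := by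
  unfold NatDiagonal at *
  unfold NatCrosses rotDiagonal
  split_ifs <;> simp only <;> omega

theorem NatDiagonal.crosses_unrot {n : ℕ} {d e : ℕ × ℕ} (hd : NatDiagonal n d)
    (he : NatDiagonal n e) :
    NatCrosses (unrotDiagonal n d) (unrotDiagonal n e) ↔ NatCrosses d e := by
  rw [← hd.unrot.crosses_rot he.unrot, hd.rot_unrot, he.rot_unrot]

theorem NatDiagonal.crosses_self_rot {n : ℕ} {d : ℕ × ℕ} (h : NatDiagonal n d) :
    NatCrosses d (rotDiagonal n d) := by
  unfold NatDiagonal at *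
  unfold NatCrosses rotDiagonal
  split_ifs <;> simp only <;> omega

/-- Equality would mean that rotation by two steps fixes the diagonal, which happens only in the
quadrilateral. This is what `5 ≤ n` is for. -/
theorem NatDiagonal.rot_ne_unrot {n : ℕ} (hn : 5 ≤ n) {d : ℕ × ℕ} (h : NatDiagonal n d) :
    rotDiagonal n d ≠ unrotDiagonal n d := by
  unfold NatDiagonal at *
  unfold rotDiagonal unrotDiagonal
  rw [ne_eq, Prod.ext_iff]
  split_ifs <;> simp only <;> omega

theorem NatCrosses.symm {d e : ℕ × ℕ} (h : NatCrosses d e) : NatCrosses e d := Or.symm h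

theorem IsTriangulation.image_rot {n : ℕ} {T : Finset (ℕ × ℕ)} (hT : IsTriangulation n T) :
    IsTriangulation n (T.image (rotDiagonal n)) := by
  refine ⟨⟨?_, ?_⟩, ?_⟩
  · simp only [Finset.forall_mem_image]
    exact fun d hd => (hT.1.1 d hd).rot
  · simp only [Finset.forall_mem_image]
    intro d hd e he
    rw [(hT.1.1 d hd).crosses_rot (hT.1.1 e he)]
    exact hT.1.2 d hd e he
  · simp only [Finset.forall_mem_image]
    intro e he hc
    refine Finset.mem_image.2 ⟨unrotDiagonal n e, hT.2 _ he.unrot fun d hd => ?_, he.rot_unrot⟩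
    rw [← (hT.1.1 d hd).crosses_rot he.unrot, he.rot_unrot]
    exact hc hd

theorem IsTriangulation.image_unrot {n : ℕ} {T : Finset (ℕ × ℕ)} (hT : IsTriangulation n T) :
    IsTriangulation n (T.image (unrotDiagonal n)) := by
  refine ⟨⟨?_, ?_⟩, ?_⟩
  · simp only [Finset.forall_mem_image]
    exact fun d hd => (hT.1.1 d hd).unrot
  · simp only [Finset.forall_mem_image]
    intro d hd e he
    rw [(hT.1.1 d hd).crosses_unrot (hT.1.1 e he)]
    exact hT.1.2 d hd e he
  · simp only [Finset.forall_mem_image]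
    intro e he hc
    refine Finset.mem_image.2 ⟨rotDiagonal n e, hT.2 _ he.rot fun d hd => ?_, he.unrot_rot⟩
    rw [← (hT.1.1 d hd).crosses_unrot he.rot, he.unrot_rot]
    exact hc hd

theorem IsTriangulation.image_unrot_image_rot {n : ℕ} {T : Finset (ℕ × ℕ)}
    (hT : IsTriangulation n T) : (T.image (rotDiagonal n)).image (unrotDiagonal n) = T := by
  rw [Finset.image_image]
  conv_rhs => rw [← Finset.image_id (s := T)]
  exact Finset.image_congr fun d hd => (hT.1.1 d hd).unrot_rot

theorem IsTriangulation.image_rot_image_unrot {n : ℕ} {T : Finset (ℕ × ℕ)}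
    (hT : IsTriangulation n T) : (T.image (unrotDiagonal n)).image (rotDiagonal n) = T := by
  rw [Finset.image_image]
  conv_rhs => rw [← Finset.image_id (s := T)]
  exact Finset.image_congr fun d hd => (hT.1.1 d hd).rot_unrot

/-- The triangulations of the `n`-gon. -/
abbrev Triangulation (n : ℕ) : Type := {T : Finset (ℕ × ℕ) // IsTriangulation n T}

instance (n : ℕ) : Finite (Triangulation n) := by
  refine Set.Finite.subset (s := ((Finset.range n ×ˢ Finset.range n).powerset : Set _))
    (Finset.finite_toSet _) fun T hT => ?_
  simp only [Finset.coe_powerset, Set.mem_preimage, Set.mem_powerset_iff, Finset.coe_subset]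
  intro d hd
  have := hT.1.1 d hd
  unfold NatDiagonal at this
  simp only [Finset.mem_product, Finset.mem_range]
  omega

/-- Rotation of triangulations. -/
def rotTriangulation (n : ℕ) : Equiv.Perm (Triangulation n) where
  toFun T := ⟨T.1.image (rotDiagonal n), T.2.image_rot⟩
  invFun T := ⟨T.1.image (unrotDiagonal n), T.2.image_unrot⟩
  left_inv T := Subtype.ext T.2.image_unrot_image_rot
  right_inv T := Subtype.ext T.2.image_rot_image_unrot

theorem coe_rotTriangulation {n : ℕ} (T : Triangulation n) :
    (rotTriangulation n T : Finset (ℕ × ℕ)) = T.1.image (rotDiagonal n) := rfl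

theorem coe_rotTriangulation_inv {n : ℕ} (T : Triangulation n) :
    ((rotTriangulation n)⁻¹ T : Finset (ℕ × ℕ)) = T.1.image (unrotDiagonal n) := rfl

/-- The triangulations have no common diagonal. -/
def DisjointTriangulations {n : ℕ} (T T' : Triangulation n) : Prop := Disjoint T.1 T'.1

theorem disjointTriangulations_self_rot {n : ℕ} (T : Triangulation n) :
    DisjointTriangulations T (rotTriangulation n T) := by
  rw [DisjointTriangulations, coe_rotTriangulation, Finset.disjoint_right]
  simp only [Finset.forall_mem_image]
  exact fun d hd hd' => T.2.1.2 d hd _ hd' (T.2.1.1 d hd).crosses_self_rot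

theorem DisjointTriangulations.rot {n : ℕ} {T T' : Triangulation n}
    (h : DisjointTriangulations T T') :
    DisjointTriangulations (rotTriangulation n T) (rotTriangulation n T') := by
  rw [DisjointTriangulations, Finset.disjoint_left] at *
  simp only [coe_rotTriangulation, Finset.forall_mem_image]
  intro d hd hd'
  obtain ⟨e, he, heq⟩ := Finset.mem_image.1 hd'
  have : e = d := by rw [← (T'.2.1.1 e he).unrot_rot, heq, (T.2.1.1 d hd).unrot_rot]
  exact h hd (this ▸ he)

theorem DisjointTriangulations.symm {n : ℕ} {T T' : Triangulation n}
    (h : DisjointTriangulations T T') : DisjointTriangulations T' T := Disjoint.symm h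

/-- A diagonal common to `T'` and a rotation of `T` by one step can only be `d'`, as the rest of
`T'` lies in `T`. If both rotations fail, the two neighbouring rotations of `d'` lie in `T` and
cross `d'`, so both equal `d`, contradicting `NatDiagonal.rot_ne_unrot`. -/
theorem IsFlip.disjoint_rot {n : ℕ} (hn : 5 ≤ n) {T T' : Triangulation n} {d d' : ℕ × ℕ}
    (h : IsFlip T.1 T'.1 d d') :
    DisjointTriangulations T' (rotTriangulation n T) ∨
      DisjointTriangulations T' ((rotTriangulation n)⁻¹ T) := by
  by_contra hc
  simp only [DisjointTriangulations, Finset.disjoint_right, not_or, not_forall, not_not,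
    coe_rotTriangulation, coe_rotTriangulation_inv, Finset.mem_image, exists_prop] at hc
  obtain ⟨⟨_, ⟨e, he, rfl⟩, he'⟩, ⟨_, ⟨f, hf, rfl⟩, hf'⟩⟩ := hc
  have hd' := T'.2.1.1 _ h.2.1
  have de := T.2.1.1 e he
  have df := T.2.1.1 f hf
  have e1 : rotDiagonal n e = d' := by
    by_contra hne
    exact T.2.1.2 e he _ (h.symm.mem_of_mem he' hne) de.crosses_self_rot
  have f1 : unrotDiagonal n f = d' := by
    by_contra hne
    have := T.2.1.2 _ (h.symm.mem_of_mem hf' hne) _ hf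
    apply this
    conv_rhs => rw [← df.rot_unrot]
    exact df.unrot.crosses_self_rot
  have e2 : e = unrotDiagonal n d' := by rw [← e1, de.unrot_rot]
  have f2 : f = rotDiagonal n d' := by rw [← f1, df.rot_unrot]
  have ce : NatCrosses e d' := by rw [← e1]; exact de.crosses_self_rot
  have cf : NatCrosses f d' := by rw [f2]; exact hd'.crosses_self_rot.symm
  by_cases hed : e = d
  · have : f ≠ d := by
      rw [← hed, e2, f2]
      exact hd'.rot_ne_unrot hn
    exact T'.2.1.2 f (h.mem_of_mem hf this) _ h.2.1 cf
  · exact T'.2.1.2 e (h.mem_of_mem he hed) _ h.2.1 ce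

theorem image_erase_of_injOn {α β : Type*} [DecidableEq α] [DecidableEq β] {f : α → β}
    {s : Finset α} (hf : Set.InjOn f s) {a : α} (ha : a ∈ s) :
    (s.image f).erase (f a) = (s.erase a).image f := by
  ext b
  simp only [Finset.mem_erase, Finset.mem_image]
  constructor
  · rintro ⟨hb, c, hc, rfl⟩
    exact ⟨c, ⟨fun h => hb (by rw [h]), hc⟩, rfl⟩
  · rintro ⟨c, ⟨hca, hc⟩, rfl⟩
    exact ⟨fun h => hca (hf hc ha h), c, hc, rfl⟩

theorem IsTriangulation.injOn_unrot {n : ℕ} {T : Finset (ℕ × ℕ)} (hT : IsTriangulation n T) :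
    Set.InjOn (unrotDiagonal n) T := fun d hd e he h => by
  rw [← (hT.1.1 d hd).rot_unrot, h, (hT.1.1 e he).rot_unrot]

theorem IsFlip.unrot {n : ℕ} {T T' : Triangulation n} {d d' : ℕ × ℕ}
    (h : IsFlip T.1 T'.1 d d') :
    IsFlip ((rotTriangulation n)⁻¹ T).1 ((rotTriangulation n)⁻¹ T').1 (unrotDiagonal n d)
      (unrotDiagonal n d') := by
  rw [coe_rotTriangulation_inv, coe_rotTriangulation_inv]
  refine ⟨Finset.mem_image_of_mem _ h.1, Finset.mem_image_of_mem _ h.2.1, fun heq => h.2.2.1 ?_, ?_⟩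
  · rw [← (T.2.1.1 d h.1).rot_unrot, heq, (T'.2.1.1 d' h.2.1).rot_unrot]
  · rw [image_erase_of_injOn T.2.injOn_unrot h.1, image_erase_of_injOn T'.2.injOn_unrot h.2.1,
      h.2.2.2]

theorem IsChord.unrot {n : ℕ} {T : Triangulation n} {i j : ℕ} (h : IsChord n T.1 i j) :
    IsChord n ((rotTriangulation n)⁻¹ T).1 (unrotDiagonal n (i, j)).1
      (unrotDiagonal n (i, j)).2 := by
  rcases h with h | h | h
  · exact Or.inl (Finset.mem_image_of_mem _ h)
  · right
    unfold unrotDiagonal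
    split_ifs <;> simp only at * <;> omega
  · right
    unfold unrotDiagonal
    split_ifs <;> simp only at * <;> omega

theorem IsChord.rot {n : ℕ} {T : Triangulation n} {i j : ℕ} (h : IsChord n T.1 i j) :
    IsChord n (rotTriangulation n T).1 (rotDiagonal n (i, j)).1 (rotDiagonal n (i, j)).2 := by
  rcases h with h | h | h
  · exact Or.inl (Finset.mem_image_of_mem _ h)
  · right
    unfold rotDiagonal
    split_ifs <;> simp only [true_and] <;> omega
  · right
    unfold rotDiagonal
    split_ifs <;> simp only [true_and] <;> omega

theorem IsChord.unrot_succ {n : ℕ} {T : Triangulation n} {i j : ℕ}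
    (h : IsChord n T.1 (i + 1) (j + 1)) : IsChord n ((rotTriangulation n)⁻¹ T).1 i j := h.unrot

theorem IsChord.unrot_zero {n : ℕ} {T : Triangulation n} {j : ℕ}
    (h : IsChord n T.1 0 (j + 1)) : IsChord n ((rotTriangulation n)⁻¹ T).1 j (n - 1) := h.unrot

theorem IsChord.rot_succ {n : ℕ} {T : Triangulation n} {i j : ℕ}
    (h : IsChord n T.1 i j) (hj : j + 1 < n) :
    IsChord n (rotTriangulation n T).1 (i + 1) (j + 1) := by
  have := h.rot
  simpa only [rotDiagonal, hj, if_true] using this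

theorem IsChord.rot_last {n : ℕ} {T : Triangulation n} {i j : ℕ}
    (h : IsChord n T.1 i j) (hj : ¬ j + 1 < n) :
    IsChord n (rotTriangulation n T).1 0 (i + 1) := by
  have := h.rot
  simpa only [rotDiagonal, hj, if_false] using this

/-! ### Labelling flips by short apices. -/

/-- The vertex `m` spans a triangle of `T` with the diagonal `d`, on a side of `d` which contains at
most half of the boundary of the `n`-gon. -/
def IsShortApex (n : ℕ) (T : Finset (ℕ × ℕ)) (d : ℕ × ℕ) (m : ℕ) : Prop :=
  d ∈ T ∧
    ((d.1 < m ∧ m < d.2 ∧ 2 * (d.2 - d.1) ≤ n ∧ IsChord n T d.1 m ∧ IsChord n T m d.2) ∨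
    (m < d.1 ∧ n ≤ 2 * (d.2 - d.1) ∧ IsChord n T m d.1 ∧ IsChord n T m d.2) ∨
    (d.2 < m ∧ m < n ∧ n ≤ 2 * (d.2 - d.1) ∧ IsChord n T d.1 m ∧ IsChord n T d.2 m))

theorem IsTriangulation.exists_isShortApex {n : ℕ} {T : Finset (ℕ × ℕ)}
    (hT : IsTriangulation n T) {d : ℕ × ℕ} (hd : d ∈ T) : ∃ m, IsShortApex n T d m := by
  obtain ⟨a, b⟩ := d
  by_cases h : 2 * (b - a) ≤ n
  · obtain ⟨m, h1, h2, h3, h4⟩ := hT.exists_apex (Or.inl hd) (hT.1.1 _ hd).1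
    exact ⟨m, hd, Or.inl ⟨h1, h2, h, h3, h4⟩⟩
  · rcases hT.exists_outer_apex hd with ⟨m, h1, h2, h3⟩ | ⟨m, h1, h2, h3⟩
    · exact ⟨m, hd, Or.inr (Or.inl ⟨h1, by simp only; omega, h2, h3⟩)⟩
    · exact ⟨m, hd, Or.inr (Or.inr ⟨h1, (hT.1.isChord_lt h2).2, by simp only; omega, h2, h3⟩)⟩

theorem IsShortApex.unrot {n : ℕ} {T : Triangulation n} {d : ℕ × ℕ} {m : ℕ}
    (h : IsShortApex n T.1 d (m + 1)) :
    IsShortApex n ((rotTriangulation n)⁻¹ T).1 (unrotDiagonal n d) m := by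
  obtain ⟨hd, h⟩ := h
  refine ⟨Finset.mem_image_of_mem _ hd, ?_⟩
  have hdd := T.2.1.1 _ hd
  obtain ⟨a, b⟩ := d
  simp only [NatDiagonal] at hdd
  obtain ⟨b, rfl⟩ : ∃ b', b = b' + 1 := ⟨b - 1, by omega⟩
  simp only at h
  cases a with
  | zero =>
    -- A diagonal at 0 wraps around under the rotation, so its inner and outer sides trade places.
    simp only [unrotDiagonal, if_true, Nat.add_sub_cancel]
    rcases h with ⟨h1, h2, h3, h4, h5⟩ | ⟨h1, h2, h4, h5⟩ | ⟨h1, h2, h3, h4, h5⟩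
    · exact Or.inr (Or.inl ⟨by omega, by omega, h5.unrot_succ, h4.unrot_zero⟩)
    · omega
    · exact Or.inl ⟨by omega, by omega, by omega, h5.unrot_succ, h4.unrot_zero⟩
  | succ a =>
    simp only [unrotDiagonal, Nat.succ_ne_zero, if_false, Nat.add_sub_cancel]
    rcases h with ⟨h1, h2, h3, h4, h5⟩ | ⟨h1, h2, h4, h5⟩ | ⟨h1, h2, h3, h4, h5⟩
    · exact Or.inl ⟨by omega, by omega, by omega, h4.unrot_succ, h5.unrot_succ⟩
    · exact Or.inr (Or.inl ⟨by omega, by omega, h4.unrot_succ, h5.unrot_succ⟩)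
    · exact Or.inr (Or.inr ⟨by omega, by omega, by omega, h4.unrot_succ, h5.unrot_succ⟩)

theorem IsShortApex.rot {n : ℕ} {T : Triangulation n} {d : ℕ × ℕ} {m : ℕ} (hm : m + 1 < n)
    (h : IsShortApex n T.1 d m) :
    IsShortApex n (rotTriangulation n T).1 (rotDiagonal n d) (m + 1) := by
  obtain ⟨hd, h⟩ := h
  refine ⟨Finset.mem_image_of_mem _ hd, ?_⟩
  have hdd := T.2.1.1 _ hd
  obtain ⟨a, b⟩ := d
  simp only [NatDiagonal] at hdd
  simp only at h
  by_cases hb : b + 1 < n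
  · simp only [rotDiagonal, hb, if_true]
    rcases h with ⟨h1, h2, h3, h4, h5⟩ | ⟨h1, h2, h4, h5⟩ | ⟨h1, h2, h3, h4, h5⟩
    · exact Or.inl ⟨by omega, by omega, by omega, h4.rot_succ hm, h5.rot_succ hb⟩
    · exact Or.inr (Or.inl ⟨by omega, by omega, h4.rot_succ (by omega), h5.rot_succ hb⟩)
    · exact Or.inr (Or.inr ⟨by omega, by omega, by omega, h4.rot_succ hm, h5.rot_succ hm⟩)
  · simp only [rotDiagonal, hb, if_false]
    rcases h with ⟨h1, h2, h3, h4, h5⟩ | ⟨h1, h2, h4, h5⟩ | ⟨h1, h2, h3, h4, h5⟩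
    · exact Or.inr (Or.inr ⟨by omega, by omega, by omega, h5.rot_last hb, h4.rot_succ hm⟩)
    · exact Or.inl ⟨by omega, by omega, by omega, h5.rot_last hb, h4.rot_succ (by omega)⟩
    · omega

/-- The triangles at the vertex 0 have opposite sides spanning intervals with disjoint interiors in
`[1, n - 1]`. A short apex makes such an interval at least `n / 2` long, and there is no room for
two. -/
theorem IsShortApex.unique_zero {n : ℕ} {T : Finset (ℕ × ℕ)} (hT : IsTriangulation n T)
    {d e : ℕ × ℕ} (hd : IsShortApex n T d 0) (he : IsShortApex n T e 0) : d = e := by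
  obtain ⟨hd, h⟩ := hd
  obtain ⟨he, h'⟩ := he
  obtain ⟨a, b⟩ := d
  obtain ⟨p, q⟩ := e
  have hdd := hT.1.1 _ hd
  have hee := hT.1.1 _ he
  have c1 := hT.1.2 _ hd _ he
  simp only [NatDiagonal, NatCrosses] at hdd hee c1 h h'
  have k : ∀ i, IsChord n T 0 i → ¬ (a < i ∧ i < b) ∧ ¬ (p < i ∧ i < q) := by
    intro i hi
    have l := hT.1.isChord_lt hi
    have k1 := hT.1.isChord_noncrossing hi (Or.inl hd)
    have k2 := hT.1.isChord_noncrossing hi (Or.inl he)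
    have k3 : 0 < a := by omega
    have k4 : 0 < p := by omega
    omega
  rcases h with h | ⟨h1, h2, h3, h4⟩ | h
  · omega
  · rcases h' with h' | ⟨h1', h2', h3', h4'⟩ | h'
    · omega
    · have := k _ h3
      have := k _ h4
      have := k _ h3'
      have := k _ h4'
      ext <;> simp only <;> omega
    · omega
  · omega

/-- An endpoint of a diagonal that splits the boundary most evenly is never a short apex. If it were
one for `(p, q)`, noncrossing would put the chosen diagonal inside the short side of `(p, q)`, so
`(p, q)` would split more evenly. -/
theorem IsTriangulation.exists_not_isShortApex {n : ℕ} (hn : 0 < n) {T : Finset (ℕ × ℕ)}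
    (hT : IsTriangulation n T) : ∃ m < n, ∀ d, ¬ IsShortApex n T d m := by
  by_cases hne : T.Nonempty
  · obtain ⟨⟨i, j⟩, hd, hmax⟩ := Finset.exists_max_image T
      (fun c => min (c.2 - c.1) (n - (c.2 - c.1))) hne
    have hdd := hT.1.1 _ hd
    simp only [NatDiagonal] at hdd
    refine ⟨i, by omega, ?_⟩
    rintro ⟨p, q⟩ ⟨he, h⟩
    have c := hT.1.2 _ hd _ he
    have hee := hT.1.1 _ he
    have hle := hmax _ he
    simp only [NatDiagonal, NatCrosses] at hee c h hle
    omega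
  · refine ⟨0, hn, fun d hd => hne ⟨d, hd.1⟩⟩

/-- Up to rotation every flip thus has label 0, so an orbit meets all its flips through this one
vertex. -/
theorem IsFlip.exists_isShortApex_zero {n : ℕ} {T T' : Triangulation n} {d d' : ℕ × ℕ}
    (h : IsFlip T.1 T'.1 d d') :
    ∃ (k : ℕ) (e e' : ℕ × ℕ),
      IsFlip (((rotTriangulation n)⁻¹ ^ k) T).1 (((rotTriangulation n)⁻¹ ^ k) T').1 e e' ∧
        IsShortApex n (((rotTriangulation n)⁻¹ ^ k) T).1 e 0 := by
  obtain ⟨m, hm⟩ := T.2.exists_isShortApex h.1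
  induction m generalizing T T' d d' with
  | zero => exact ⟨0, d, d', h, hm⟩
  | succ m ih =>
    obtain ⟨k, e, e', h1, h2⟩ := ih h.unrot hm.unrot
    refine ⟨k + 1, e, e', ?_⟩
    simp only [pow_succ, Equiv.Perm.mul_apply]
    exact ⟨h1, h2⟩

theorem exists_rot_not_isShortApex_zero {n : ℕ} (hn : 0 < n) (T : Triangulation n) :
    ∃ k : ℕ, ∀ d, ¬ IsShortApex n (((rotTriangulation n)⁻¹ ^ k) T).1 d 0 := by
  obtain ⟨m, hm, h⟩ := T.2.exists_not_isShortApex hn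
  induction m generalizing T with
  | zero => exact ⟨0, h⟩
  | succ m ih =>
    obtain ⟨k, hk⟩ := ih ((rotTriangulation n)⁻¹ T) (by omega) (fun d hd => by
      have := hd.rot hm
      rw [← Equiv.Perm.mul_apply, mul_inv_cancel, Equiv.Perm.one_apply] at this
      exact h _ this)
    refine ⟨k + 1, ?_⟩
    simp only [pow_succ, Equiv.Perm.mul_apply]
    exact hk

/-! ### Hamiltonian cycles as cyclic lists. -/

/-- Cyclically consecutive entries of the list are related. -/
def IsCyclicChain {X : Type*} (R : X → X → Prop) (L : List X) : Prop :=
  L.IsChain R ∧ ∀ a ∈ L.getLast?, ∀ b ∈ L.head?, R a b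

/-- `v` follows `u` in the cyclic list `L`. -/
def IsCyclicEdge {X : Type*} (L : List X) (u v : X) : Prop :=
  [u, v] <:+: L ∨ (L.getLast? = some u ∧ L.head? = some v)

theorem IsCyclicChain.rel {X : Type*} {R : X → X → Prop} {L : List X} (h : IsCyclicChain R L)
    {u v : X} (huv : IsCyclicEdge L u v) : R u v := by
  rcases huv with huv | ⟨h1, h2⟩
  · simpa using h.1.infix huv
  · exact h.2 u h1 v h2

theorem IsCyclicChain.reverse {X : Type*} {R : X → X → Prop} {L : List X}
    (h : IsCyclicChain R L) : IsCyclicChain (fun a b => R b a) L.reverse := by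
  refine ⟨List.isChain_reverse.2 h.1, fun a ha b hb => ?_⟩
  rw [List.getLast?_reverse] at ha
  rw [List.head?_reverse] at hb
  exact h.2 b hb a ha

theorem IsCyclicEdge.reverse {X : Type*} {L : List X} {u v : X}
    (h : IsCyclicEdge L u v) : IsCyclicEdge L.reverse v u := by
  rcases h with h | ⟨h1, h2⟩
  · exact Or.inl (by simpa using List.reverse_infix.2 h)
  · exact Or.inr (by simp [h1, h2])

/-- Cutting `L` between `x` and `y` and exchanging the two halves turns the old closing edge into an
inner one. Edges are compared as unordered pairs because a cycle of two elements traverses the same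
edge twice. -/
theorem IsCyclicEdge.exists_path {X : Type*} {L : List X} {x y : X}
    (hxy : IsCyclicEdge L x y) :
    ∃ M : List X, M.Perm L ∧ M.head? = some y ∧ M.getLast? = some x ∧
      (∀ R : X → X → Prop, IsCyclicChain R L → M.IsChain R) ∧
      ∀ u v, IsCyclicEdge L u v → s(u, v) ≠ s(x, y) → [u, v] <:+: M := by
  rcases hxy with ⟨A, B, hL⟩ | ⟨h1, h2⟩
  · have hL' : L = (A ++ [x]) ++ (y :: B) := by rw [← hL]; simp
    refine ⟨(y :: B) ++ (A ++ [x]), ?_, by simp, by rw [← List.append_assoc]; exact List.getLast?_concat,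
      ?_, ?_⟩
    · rw [hL']
      exact List.perm_append_comm
    · rintro R ⟨hR, hR'⟩
      rw [hL'] at hR hR'
      rw [List.isChain_append] at hR
      refine List.isChain_append.2 ⟨hR.2.1, hR.1, fun a ha b hb => hR' a ?_ b ?_⟩
      · rw [List.getLast?_append]
        simp only [Option.mem_def] at ha
        simp [ha]
      · rw [List.head?_append]
        simp only [Option.mem_def] at hb
        simp [hb]
    · have key : IsCyclicChain (fun u v => s(u, v) ≠ s(x, y) →
          [u, v] <:+: (y :: B) ++ (A ++ [x])) L := by
        rw [hL']
        refine ⟨List.isChain_append.2 ⟨?_, ?_, ?_⟩, ?_⟩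
        · exact (List.isChain_isInfix _).imp fun a b h _ => h.trans (List.suffix_append _ _).isInfix
        · exact (List.isChain_isInfix _).imp fun a b h _ => h.trans (List.prefix_append _ _).isInfix
        · intro a ha b hb hne
          simp only [List.getLast?_append, List.getLast?_singleton, Option.some_or, Option.mem_def,
            Option.some.injEq, List.head?_cons] at ha hb
          exact absurd (by rw [ha, hb]) hne
        · intro a ha b hb _
          have ha' : a ∈ (y :: B).getLast? := by
            rw [List.getLast?_append] at ha
            simpa [List.getLast?_cons] using ha
          have hb' : b ∈ (A ++ [x]).head? := by
            rw [List.head?_append] at hb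
            cases A <;> simpa using hb
          obtain ⟨C, hC⟩ := List.mem_getLast?_eq_getLast ha' |> fun ⟨h, e⟩ =>
            (⟨(y :: B).dropLast, by rw [e, List.dropLast_append_getLast]⟩ :
              ∃ C, C ++ [a] = y :: B)
          obtain ⟨D, hD⟩ : ∃ D, b :: D = A ++ [x] := ⟨_, List.cons_head?_tail hb'⟩
          exact ⟨C, D, by rw [← hC, ← hD]; simp⟩
      intro u v huv
      exact key.rel huv
  · refine ⟨L, List.Perm.refl _, h2, h1, fun R hR => hR.1, fun u v huv hne => ?_⟩
    rcases huv with huv | ⟨h3, h4⟩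
    · exact huv
    · rw [h1] at h3
      rw [h2] at h4
      exact absurd (by rw [Option.some.inj h3, Option.some.inj h4]) hne

/-- Opening a cyclic list at an edge, in the given direction. -/
theorem IsCyclicChain.exists_path {X : Type*} {adj : X → X → Prop}
    (hsymm : ∀ x y, adj x y → adj y x) {L : List X} (hL : IsCyclicChain adj L) {x y : X}
    (hxy : IsCyclicEdge L x y ∨ IsCyclicEdge L y x) :
    ∃ M : List X, M.Perm L ∧ M.head? = some y ∧ M.getLast? = some x ∧ M.IsChain adj ∧
      ∀ u v, IsCyclicEdge L u v ∨ IsCyclicEdge L v u → s(u, v) ≠ s(x, y) →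
        [u, v] <:+: M ∨ [v, u] <:+: M := by
  rcases hxy with hxy | hxy
  · obtain ⟨M, h1, h2, h3, h4, h5⟩ := hxy.exists_path
    refine ⟨M, h1, h2, h3, h4 _ hL, fun u v huv hne => ?_⟩
    rcases huv with huv | huv
    · exact Or.inl (h5 _ _ huv hne)
    · exact Or.inr (h5 _ _ huv (by rwa [Sym2.eq_swap]))
  · obtain ⟨M, h1, h2, h3, h4, h5⟩ := hxy.reverse.exists_path
    refine ⟨M, h1.trans (List.reverse_perm L), h2, h3, h4 _ ?_, fun u v huv hne => ?_⟩
    · exact ⟨hL.reverse.1.imp fun a b h => hsymm _ _ h,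
        fun a ha b hb => hsymm _ _ (hL.reverse.2 a ha b hb)⟩
    rcases huv with huv | huv
    · exact Or.inr (h5 _ _ huv.reverse (by rwa [Sym2.eq_swap]))
    · exact Or.inl (h5 _ _ huv.reverse hne)

/-- The cyclic list of the elements of a cycle of a permutation. -/
theorem Equiv.Perm.exists_cyclic_list {X : Type*} [Finite X] (r : Equiv.Perm X) {y : X}
    (hy : r y ≠ y) :
    ∃ L : List X, L.Nodup ∧ (∀ z, z ∈ L ↔ r.SameCycle y z) ∧
      (∀ R : X → X → Prop, (∀ z, R z (r z)) → IsCyclicChain R L) ∧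
      ∀ z, r.SameCycle y z → IsCyclicEdge L z (r z) := by
  classical
  have := Fintype.ofFinite X
  have hlen : (r.toList y).length = (r.cycleOf y).support.card := Equiv.Perm.length_toList ..
  have h2 : 2 ≤ (r.toList y).length := Equiv.Perm.two_le_length_toList_iff_mem_support.2
    (Equiv.Perm.mem_support.2 hy)
  have hget : ∀ (k : ℕ) (hk : k < (r.toList y).length), (r.toList y)[k] = (r ^ k) y := fun k hk =>
    Equiv.Perm.getElem_toList ..
  have hper : (r ^ (r.toList y).length) y = y := by
    rw [hlen, ← Equiv.Perm.IsCycle.orderOf (Equiv.Perm.isCycle_cycleOf r hy),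
      ← Equiv.Perm.cycleOf_pow_apply_self, pow_orderOf_eq_one, Equiv.Perm.one_apply]
  have hhead : (r.toList y).head? = some y := by
    rw [List.head?_eq_getElem?, List.getElem?_eq_getElem (by omega), hget]
    rfl
  have hlast : (r.toList y).getLast? = some ((r ^ ((r.toList y).length - 1)) y) := by
    rw [List.getLast?_eq_getElem?, List.getElem?_eq_getElem (by omega), hget]
  have hrlast : r ((r ^ ((r.toList y).length - 1)) y) = y := by
    rw [← Equiv.Perm.mul_apply, ← pow_succ', Nat.sub_add_cancel (by omega), hper]
  refine ⟨r.toList y, Equiv.Perm.nodup_toList .., fun z => ?_, ?_, ?_⟩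
  · rw [Equiv.Perm.mem_toList_iff]
    simp [hy]
  · refine fun R hR => ⟨List.isChain_iff_getElem.2 fun i hi => ?_, ?_⟩
    · rw [hget, hget, pow_succ', Equiv.Perm.mul_apply]
      exact hR _
    · rw [hhead, hlast]
      rintro _ ⟨⟩ _ ⟨⟩
      have := hR ((r ^ ((r.toList y).length - 1)) y)
      rwa [hrlast] at this
  · intro z hz
    have hz' : z ∈ r.toList y := by
      rw [Equiv.Perm.mem_toList_iff]
      simp [hy, hz]
    obtain ⟨k, hk, rfl⟩ := List.getElem_of_mem hz'
    rw [hget]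
    by_cases hk1 : k + 1 < (r.toList y).length
    · left
      refine ⟨(r.toList y).take k, (r.toList y).drop (k + 2), ?_⟩
      have e2 : r ((r ^ k) y) = (r.toList y)[k + 1] := by
        rw [hget, pow_succ', Equiv.Perm.mul_apply]
      rw [e2, ← hget k hk]
      conv_rhs => rw [← List.take_append_drop k (r.toList y), List.drop_eq_getElem_cons hk,
        List.drop_eq_getElem_cons hk1]
      simp
    · right
      have : k = (r.toList y).length - 1 := by omega
      rw [this, hrlast]
      exact ⟨hlast, hhead⟩

/-! ### Merging the cycles of a permutation. -/

section Merge

variable {X : Type*} [Fintype X] (r : Equiv.Perm X) (link : X → X → Prop)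

/-- The set of cycles of a permutation. -/
abbrev PermOrbit {X : Type*} (r : Equiv.Perm X) : Type _ := Quotient (Equiv.Perm.SameCycle.setoid r)

/-- The cycle containing a given element. -/
abbrev permOrbit {X : Type*} (r : Equiv.Perm X) (x : X) : PermOrbit r :=
  Quotient.mk (Equiv.Perm.SameCycle.setoid r) x

theorem permOrbit_eq {X : Type*} {r : Equiv.Perm X} {x y : X} :
    permOrbit r x = permOrbit r y ↔ r.SameCycle x y := Quotient.eq

theorem permOrbit_apply {X : Type*} {r : Equiv.Perm X} {x : X} :
    permOrbit r (r x) = permOrbit r x :=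
  permOrbit_eq.2 (Equiv.Perm.sameCycle_apply_left.2 (Equiv.Perm.SameCycle.refl _ _))

/-- Distinct cycles are linked if they have linked elements. -/
def OrbitLink {X : Type*} (r : Equiv.Perm X) (link : X → X → Prop) (p q : PermOrbit r) : Prop :=
  p ≠ q ∧ ∃ a b, permOrbit r a = p ∧ permOrbit r b = q ∧ link a b

open Classical in
/-- The elements of a cycle. -/
noncomputable def orbitFinset (q : PermOrbit r) : Finset X :=
  Finset.univ.filter fun x => permOrbit r x = q

open Classical in
/-- The number of elements of a cycle that give the same unordered edge `{x, r x}`. -/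
noncomputable def orbitWeight (q : PermOrbit r) : ℕ :=
  if ∃ x, permOrbit r x = q ∧ r (r x) = x then 2 else 1

open Classical in
/-- The elements that give the same unordered edge as `x`. -/
noncomputable def edgeClass (x : X) : Finset X :=
  Finset.univ.filter fun z => s(z, r z) = s(x, r x)

theorem mem_orbitFinset {q : PermOrbit r} {x : X} : x ∈ orbitFinset r q ↔ permOrbit r x = q := by
  simp [orbitFinset]

theorem mem_edgeClass {x z : X} : z ∈ edgeClass r x ↔ s(z, r z) = s(x, r x) := by
  simp [edgeClass]

theorem permOrbit_of_mem_edgeClass {x z : X} (h : z ∈ edgeClass r x) :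
    permOrbit r z = permOrbit r x := by
  rw [mem_edgeClass, Sym2.eq_iff] at h
  rcases h with h | h
  · rw [h.1]
  · rw [h.1, permOrbit_apply]

theorem card_edgeClass_le (x : X) : (edgeClass r x).card ≤ orbitWeight r (permOrbit r x) := by
  classical
  have hsub : edgeClass r x ⊆ {x, r x} := by
    intro z hz
    rw [mem_edgeClass, Sym2.eq_iff] at hz
    rcases hz with h | h <;> simp [h.1]
  unfold orbitWeight
  split_ifs with h
  · exact (Finset.card_le_card hsub).trans Finset.card_le_two
  · push Not at h
    have : edgeClass r x ⊆ {x} := by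
      intro z hz
      rw [mem_edgeClass, Sym2.eq_iff] at hz
      rcases hz with h' | h'
      · simp [h'.1]
      · exact absurd (by rw [← h'.1, h'.2]) (h x rfl)
    exact (Finset.card_le_card this).trans (by simp)

open Classical in
/-- The number of cycles linked with a given one. -/
noncomputable def orbitDegree (q : PermOrbit r) : ℕ :=
  (Finset.univ.filter fun p => OrbitLink r link q p).card

/-- The weight is 2 only if the cycle has at most two elements. Then the degree is at most 1, and
the single edge of the cycle suffices. -/
theorem orbitWeight_mul_degree_le {q : PermOrbit r}
    (h : orbitDegree r link q < (orbitFinset r q).card) :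
    orbitWeight r q * orbitDegree r link q ≤ (orbitFinset r q).card := by
  classical
  unfold orbitWeight
  split_ifs with hw
  · obtain ⟨x, hx, hxx⟩ := hw
    have hsub : orbitFinset r q ⊆ {x, r x} := by
      intro z hz
      rw [mem_orbitFinset, ← hx, eq_comm, permOrbit_eq] at hz
      obtain ⟨i, rfl⟩ := hz.exists_nat_pow_eq
      clear hz
      induction i with
      | zero => simp
      | succ i ih =>
        rw [pow_succ', Equiv.Perm.mul_apply]
        simp only [Finset.mem_insert, Finset.mem_singleton] at ih ⊢
        rcases ih with ih | ih
        · right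
          rw [ih]
        · left
          rw [ih, hxx]
    have := (Finset.card_le_card hsub).trans Finset.card_le_two
    omega
  · omega

variable {r link}

open Classical in
/-- A cyclic list through the cycles in `S`, which uses all the edges `{x, r x}` for `x ∉ R`. -/
structure MergeState {X : Type*} [Fintype X] (adj : X → X → Prop) (r : Equiv.Perm X)
    (link : X → X → Prop) (S : Finset (PermOrbit r)) (L : List X) (R : Finset X) : Prop where
  nodup : L.Nodup
  mem_iff : ∀ x, x ∈ L ↔ permOrbit r x ∈ S
  chain : IsCyclicChain adj L
  edge : ∀ x, permOrbit r x ∈ S → x ∉ R → IsCyclicEdge L x (r x) ∨ IsCyclicEdge L (r x) x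
  removed : ∀ x ∈ R, permOrbit r x ∈ S
  card_removed : ∀ q ∈ S, (R ∩ orbitFinset r q).card ≤
    orbitWeight r q * (S.filter fun p => OrbitLink r link q p).card

open Classical in
-- One edge `{x, r x}` of the long cycle and one edge `{y, r y}` of the new orbit are exchanged for
-- `{x, y}` and `{r x, r y}`. The set `R` records the edges given up, and the bound on `R` charges
-- each of them to a linked pair of orbits inside `S`.
theorem MergeState.step {adj : X → X → Prop} (hsymm : ∀ x y, adj x y → adj y x)
    (hadj : ∀ x y, adj x y → adj (r x) (r y)) (hr : ∀ x, adj x (r x)) (hfix : ∀ x, r x ≠ x)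
    (hlink : ∀ x y, link x y → adj x y) (hlinkr : ∀ x y, link x y → link (r x) (r y))
    (hlinks : ∀ x y, link x y → link y x)
    (hdeg : ∀ q, orbitDegree r link q < (orbitFinset r q).card)
    {S : Finset (PermOrbit r)} {L : List X} {R : Finset X} (h : MergeState adj r link S L R)
    {q q' : PermOrbit r} (hq : q ∈ S) (hq' : q' ∉ S) (hqq : OrbitLink r link q q') :
    ∃ L' R', MergeState adj r link (insert q' S) L' R' := by
  have hdegS : (S.filter fun p => OrbitLink r link q p).card + 1 ≤ orbitDegree r link q := by
    rw [Nat.succ_le_iff]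
    apply Finset.card_lt_card
    rw [Finset.ssubset_iff_of_subset (Finset.filter_subset_filter _ (Finset.subset_univ _))]
    exact ⟨q', by simpa using hqq, by simp [hq']⟩
  have hw1 : 1 ≤ orbitWeight r q := by
    unfold orbitWeight
    split_ifs <;> omega
  -- An edge of `q` is still free: `q'` is linked with `q` but lies outside `S`, so fewer than
  -- `orbitDegree r link q` merges have been charged to `q`.
  obtain ⟨x, hxq, hxR⟩ : ∃ x, permOrbit r x = q ∧ x ∉ R := by
    by_contra hcon
    push Not at hcon
    have hsub : orbitFinset r q ⊆ R ∩ orbitFinset r q := fun z hz =>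
      Finset.mem_inter.2 ⟨hcon z ((mem_orbitFinset r).1 hz), hz⟩
    have h1 := Finset.card_le_card hsub
    have h2 := h.card_removed q hq
    have h3 := orbitWeight_mul_degree_le r link (hdeg q)
    have h4 := Nat.mul_le_mul_left (orbitWeight r q) hdegS
    rw [Nat.mul_add] at h4
    omega
  -- Links are invariant under `r`, so a link between the two orbits can be moved to start at the
  -- chosen `x`.
  obtain ⟨y, hyq, hxy⟩ : ∃ y, permOrbit r y = q' ∧ link x y := by
    obtain ⟨-, a, b, ha, hb, hab⟩ := hqq
    have : r.SameCycle a x := permOrbit_eq.1 (ha.trans hxq.symm)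
    obtain ⟨i, rfl⟩ := this.exists_nat_pow_eq
    refine ⟨(r ^ i) b, ?_, ?_⟩
    · rw [← hb, permOrbit_eq, Equiv.Perm.sameCycle_pow_left]
    · clear * - hab hlinkr
      induction i with
      | zero => exact hab
      | succ i ih =>
        rw [pow_succ', Equiv.Perm.mul_apply, Equiv.Perm.mul_apply]
        exact hlinkr _ _ ih
  obtain ⟨M, hM1, hM2, hM3, hM4, hM5⟩ := h.chain.exists_path hsymm
    (h.edge x (hxq ▸ hq) hxR)
  obtain ⟨O, hO1, hO2, hO3, hO4⟩ := r.exists_cyclic_list (hfix y)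
  obtain ⟨N, hN1, hN2, hN3, hN4, hN5⟩ := (hO3 adj hr).exists_path hsymm
    (Or.inl (hO4 y (Equiv.Perm.SameCycle.refl _ _)))
  have hmemN : ∀ z, z ∈ N ↔ permOrbit r z = q' := fun z => by
    rw [hN1.mem_iff, hO2, ← hyq, eq_comm, permOrbit_eq]
  have hmemM : ∀ z, z ∈ M ↔ permOrbit r z ∈ S := fun z => by rw [hM1.mem_iff, h.mem_iff]
  -- `M` runs from `r x` to `x` and `N.reverse` from `y` to `r y`, and the closing edge is `{r y, r
  -- x}`.
  refine ⟨M ++ N.reverse, R ∪ (edgeClass r x ∪ edgeClass r y), ?_, ?_, ?_, ?_, ?_, ?_⟩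
  · refine List.Nodup.append (hM1.nodup_iff.2 h.nodup)
      (List.nodup_reverse.2 (hN1.nodup_iff.2 hO1)) fun z hz hz' => ?_
    rw [List.mem_reverse, hmemN] at hz'
    rw [hmemM, hz'] at hz
    exact hq' hz
  · intro z
    rw [List.mem_append, List.mem_reverse, hmemN, hmemM, Finset.mem_insert, or_comm]
  · refine ⟨List.isChain_append.2 ⟨hM4, ?_, ?_⟩, ?_⟩
    · rw [List.isChain_reverse]
      exact hN4.imp fun a b hab => hsymm _ _ hab
    · intro a ha b hb
      rw [List.head?_reverse, hN3] at hb
      rw [hM3] at ha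
      rw [← Option.some.inj ha, ← Option.some.inj hb]
      exact hlink _ _ hxy
    · intro a ha b hb
      rw [List.getLast?_append, List.getLast?_reverse, hN2] at ha
      rw [List.head?_append, hM2] at hb
      rw [← Option.some.inj ha, ← Option.some.inj hb]
      exact hsymm _ _ (hadj _ _ (hlink _ _ hxy))
  · intro z hz hzR
    simp only [Finset.mem_union, not_or, mem_edgeClass] at hzR
    obtain ⟨hzR, hzx, hzy⟩ := hzR
    have haux : [z, r z] <:+: M ++ N.reverse ∨ [r z, z] <:+: M ++ N.reverse := by
      rcases Finset.mem_insert.1 hz with hz | hz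
      · have := hN5 z (r z) (Or.inl (hO4 z (permOrbit_eq.1 (hyq.trans hz.symm)))) hzy
        rcases this with h' | h'
        · right
          have := List.reverse_infix.2 h'
          exact (show [r z, z] <:+: N.reverse by simpa using this).trans
            (List.suffix_append _ _).isInfix
        · left
          have := List.reverse_infix.2 h'
          exact (show [z, r z] <:+: N.reverse by simpa using this).trans
            (List.suffix_append _ _).isInfix
      · rcases hM5 z (r z) (h.edge z hz hzR) hzx with h' | h'
        · exact Or.inl (h'.trans (List.prefix_append _ _).isInfix)
        · exact Or.inr (h'.trans (List.prefix_append _ _).isInfix)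
    exact haux.imp Or.inl Or.inl
  · intro z hz
    simp only [Finset.mem_union] at hz
    rw [Finset.mem_insert]
    rcases hz with hz | hz | hz
    · exact Or.inr (h.removed z hz)
    · right
      rw [permOrbit_of_mem_edgeClass r hz, hxq]
      exact hq
    · left
      rw [permOrbit_of_mem_edgeClass r hz, hyq]
  · intro p hp
    have hmono : (S.filter fun p' => OrbitLink r link p p').card ≤
        ((insert q' S).filter fun p' => OrbitLink r link p p').card :=
      Finset.card_le_card (Finset.filter_subset_filter _ (Finset.subset_insert _ _))
    rcases Finset.mem_insert.1 hp with rfl | hp'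
    · have hsub : (R ∪ (edgeClass r x ∪ edgeClass r y)) ∩ orbitFinset r p ⊆ edgeClass r y := by
        intro z hz
        simp only [Finset.mem_inter, Finset.mem_union, mem_orbitFinset] at hz
        obtain ⟨hz | hz | hz, hzp⟩ := hz
        · exact absurd (hzp ▸ h.removed z hz) hq'
        · rw [permOrbit_of_mem_edgeClass r hz, hxq] at hzp
          exact absurd (hzp ▸ hq) hq'
        · exact hz
      have hpos : 1 ≤ ((insert p S).filter fun p' => OrbitLink r link p p').card := by
        refine Finset.card_pos.2 ⟨q, Finset.mem_filter.2 ⟨Finset.mem_insert_of_mem hq, ?_⟩⟩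
        obtain ⟨hne, a, b, ha, hb, hab⟩ := hqq
        exact ⟨hne.symm, b, a, hb, ha, hlinks _ _ hab⟩
      calc _ ≤ (edgeClass r y).card := Finset.card_le_card hsub
        _ ≤ orbitWeight r p := hyq ▸ card_edgeClass_le r y
        _ ≤ _ := Nat.le_mul_of_pos_right _ hpos
    · by_cases hpq : p = q
      · subst hpq
        have hsub : (R ∪ (edgeClass r x ∪ edgeClass r y)) ∩ orbitFinset r p ⊆
            (R ∩ orbitFinset r p) ∪ edgeClass r x := by
          intro z hz
          simp only [Finset.mem_inter, Finset.mem_union, mem_orbitFinset] at hz ⊢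
          obtain ⟨hz | hz | hz, hzp⟩ := hz
          · exact Or.inl ⟨hz, hzp⟩
          · exact Or.inr hz
          · rw [permOrbit_of_mem_edgeClass r hz, hyq] at hzp
            exact absurd (hzp ▸ hp') hq'
        have hcard : ((insert q' S).filter fun p' => OrbitLink r link p p').card =
            (S.filter fun p' => OrbitLink r link p p').card + 1 := by
          rw [Finset.filter_insert, if_pos hqq, Finset.card_insert_of_notMem]
          simp [hq']
        calc _ ≤ ((R ∩ orbitFinset r p) ∪ edgeClass r x).card := Finset.card_le_card hsub
          _ ≤ (R ∩ orbitFinset r p).card + (edgeClass r x).card := Finset.card_union_le _ _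
          _ ≤ orbitWeight r p * (S.filter fun p' => OrbitLink r link p p').card +
              orbitWeight r p := Nat.add_le_add (h.card_removed p hp') (hxq ▸ card_edgeClass_le r x)
          _ = _ := by rw [hcard, Nat.mul_add, Nat.mul_one]
      · have hsub : (R ∪ (edgeClass r x ∪ edgeClass r y)) ∩ orbitFinset r p ⊆
            R ∩ orbitFinset r p := by
          intro z hz
          simp only [Finset.mem_inter, Finset.mem_union, mem_orbitFinset] at hz ⊢
          obtain ⟨hz | hz | hz, hzp⟩ := hz
          · exact ⟨hz, hzp⟩
          · rw [permOrbit_of_mem_edgeClass r hz, hxq] at hzp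
            exact absurd hzp.symm hpq
          · rw [permOrbit_of_mem_edgeClass r hz, hyq] at hzp
            exact absurd (hzp ▸ hp') hq'
        exact ((Finset.card_le_card hsub).trans (h.card_removed p hp')).trans
          (Nat.mul_le_mul_left _ hmono)

/-- If the cycles of an automorphism `r`, which moves every vertex to a neighbour, are connected by
links, and every cycle is linked with fewer cycles than it has elements, then the graph is
Hamiltonian. -/
theorem exists_hamiltonian_list {adj : X → X → Prop} [Nonempty X]
    (hsymm : ∀ x y, adj x y → adj y x)
    (hadj : ∀ x y, adj x y → adj (r x) (r y)) (hr : ∀ x, adj x (r x)) (hfix : ∀ x, r x ≠ x)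
    (hlink : ∀ x y, link x y → adj x y) (hlinkr : ∀ x y, link x y → link (r x) (r y))
    (hlinks : ∀ x y, link x y → link y x)
    (hdeg : ∀ q, orbitDegree r link q < (orbitFinset r q).card)
    (hconn : ∀ x y, Relation.ReflTransGen (fun a b => r.SameCycle a b ∨ link a b) x y) :
    ∃ L : List X, L.Nodup ∧ (∀ x, x ∈ L) ∧ IsCyclicChain adj L := by
  classical
  have key : ∀ k : ℕ, ∀ (S : Finset (PermOrbit r)) (L : List X) (R : Finset X), S.Nonempty →
      MergeState adj r link S L R → Sᶜ.card = k →
      ∃ L R, MergeState adj r link Finset.univ L R := by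
    intro k
    induction k with
    | zero =>
      intro S L R _ h hk
      rw [Finset.card_eq_zero, Finset.compl_eq_empty_iff] at hk
      exact ⟨L, R, hk ▸ h⟩
    | succ k ih =>
      intro S L R ⟨q₀, hq₀⟩ h hk
      -- If no link left `S`, connectedness would put every orbit into `S`.
      have hex : ∃ q q', q ∈ S ∧ q' ∉ S ∧ OrbitLink r link q q' := by
        by_contra hcon
        push Not at hcon
        have : ∀ p, p ∈ S := by
          intro p
          obtain ⟨x, rfl⟩ := Quotient.exists_rep q₀
          obtain ⟨y, rfl⟩ := Quotient.exists_rep p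
          have hxy := hconn x y
          induction hxy with
          | refl => exact hq₀
          | @tail b c _ hbc ihb =>
            rcases hbc with hbc | hbc
            · have e : permOrbit r b = permOrbit r c := permOrbit_eq.2 hbc
              change permOrbit r c ∈ S
              exact e ▸ ihb
            · by_contra hc
              exact hcon _ _ ihb hc ⟨fun he => hc (he ▸ ihb), b, c, rfl, rfl, hbc⟩
        rw [Finset.eq_univ_iff_forall.2 this] at hk
        simp at hk
      obtain ⟨q, q', hq, hq', hqq⟩ := hex
      obtain ⟨L', R', h'⟩ := h.step hsymm hadj hr hfix hlink hlinkr hlinks hdeg hq hq' hqq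
      refine ih _ L' R' ⟨q', Finset.mem_insert_self _ _⟩ h' ?_
      have h1 := Finset.card_compl_add_card S
      have h2 := Finset.card_compl_add_card (insert q' S)
      rw [Finset.card_insert_of_notMem hq'] at h2
      omega
  obtain ⟨y⟩ := ‹Nonempty X›
  obtain ⟨O, hO1, hO2, hO3, hO4⟩ := r.exists_cyclic_list (hfix y)
  obtain ⟨L, R, h⟩ := key _ {permOrbit r y} O ∅ (Finset.singleton_nonempty _) (by
    refine ⟨hO1, fun z => ?_, hO3 adj hr, fun z hz _ => ?_, by simp, by simp⟩
    · rw [hO2, Finset.mem_singleton, eq_comm, permOrbit_eq]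
    · rw [Finset.mem_singleton, eq_comm, permOrbit_eq] at hz
      exact Or.inl (hO4 z hz)) rfl
  exact ⟨L, h.nodup, fun x => (h.mem_iff x).2 (Finset.mem_univ _), h.chain⟩

/-- The degree bound follows from a function which enumerates the linked cycles. -/
theorem orbitDegree_lt (g : X → X)
    (hg : ∀ x y, link x y → ∃ z, r.SameCycle x z ∧ r.SameCycle (g z) y)
    (hg' : ∀ x, ∃ z, r.SameCycle x z ∧ g z = z) (q : PermOrbit r) :
    orbitDegree r link q < (orbitFinset r q).card := by
  classical
  obtain ⟨x, rfl⟩ := Quotient.exists_rep q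
  obtain ⟨z₀, h1, h2⟩ := hg' x
  have hz₀ : z₀ ∈ orbitFinset r (permOrbit r x) := by
    rw [mem_orbitFinset, eq_comm, permOrbit_eq]
    exact h1
  -- The element `z₀` fixed by `g` can be omitted, since it leads back to its own orbit, which is
  -- not linked with itself.
  have hsub : (Finset.univ.filter fun p => OrbitLink r link (permOrbit r x) p) ⊆
      ((orbitFinset r (permOrbit r x)).erase z₀).image fun z => permOrbit r (g z) := by
    intro p hp
    obtain ⟨hne, a, b, ha, hb, hab⟩ := (Finset.mem_filter.1 hp).2
    obtain ⟨z, hz1, hz2⟩ := hg a b hab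
    refine Finset.mem_image.2 ⟨z, Finset.mem_erase.2 ⟨?_, ?_⟩, ?_⟩
    · rintro rfl
      rw [h2] at hz2
      exact hne (by rw [← ha, ← hb, permOrbit_eq]; exact hz1.trans hz2)
    · rw [mem_orbitFinset, ← ha, eq_comm, permOrbit_eq]
      exact hz1
    · rw [← hb, permOrbit_eq]
      exact hz2
  calc orbitDegree r link _ ≤ _ := Finset.card_le_card hsub
    _ ≤ _ := Finset.card_image_le
    _ < _ := Finset.card_erase_lt_of_mem hz₀

end Merge

/-! ### The Hamiltonian cycle of disjoint triangulations. -/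

theorem IsTriangulation.injOn_rot {n : ℕ} {T : Finset (ℕ × ℕ)} (hT : IsTriangulation n T) :
    Set.InjOn (rotDiagonal n) T := fun d hd e he h => by
  rw [← (hT.1.1 d hd).unrot_rot, h, (hT.1.1 e he).unrot_rot]

theorem IsFlip.rot {n : ℕ} {T T' : Triangulation n} {d d' : ℕ × ℕ}
    (h : IsFlip T.1 T'.1 d d') :
    IsFlip (rotTriangulation n T).1 (rotTriangulation n T').1 (rotDiagonal n d)
      (rotDiagonal n d') := by
  rw [coe_rotTriangulation, coe_rotTriangulation]
  refine ⟨Finset.mem_image_of_mem _ h.1, Finset.mem_image_of_mem _ h.2.1, fun heq => h.2.2.1 ?_, ?_⟩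
  · rw [← (T.2.1.1 d h.1).unrot_rot, heq, (T'.2.1.1 d' h.2.1).unrot_rot]
  · rw [image_erase_of_injOn T.2.injOn_rot h.1, image_erase_of_injOn T'.2.injOn_rot h.2.1,
      h.2.2.2]

theorem IsFlip.rot_pow {n : ℕ} {T T' : Triangulation n} {d d' : ℕ × ℕ}
    (h : IsFlip T.1 T'.1 d d') (i : ℕ) :
    ∃ e e', IsFlip ((rotTriangulation n ^ i) T).1 ((rotTriangulation n ^ i) T').1 e e' := by
  induction i with
  | zero => exact ⟨d, d', h⟩
  | succ i ih =>
    obtain ⟨e, e', h'⟩ := ih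
    simp only [pow_succ', Equiv.Perm.mul_apply]
    exact ⟨_, _, h'.rot⟩

/-- The triangulations are disjoint, and agree up to one flip and a rotation. -/
def TriangulationLink {n : ℕ} (T T' : Triangulation n) : Prop :=
  DisjointTriangulations T T' ∧
    ∃ U : Triangulation n, (∃ d d', IsFlip T.1 U.1 d d') ∧ (rotTriangulation n).SameCycle U T'

theorem TriangulationLink.rot {n : ℕ} {T T' : Triangulation n} (h : TriangulationLink T T') :
    TriangulationLink (rotTriangulation n T) (rotTriangulation n T') := by
  obtain ⟨h1, U, ⟨d, d', h2⟩, h3⟩ := h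
  exact ⟨h1.rot, _, ⟨_, _, h2.rot⟩,
    Equiv.Perm.sameCycle_apply_left.2 (Equiv.Perm.sameCycle_apply_right.2 h3)⟩

theorem TriangulationLink.symm {n : ℕ} {T T' : Triangulation n} (h : TriangulationLink T T') :
    TriangulationLink T' T := by
  obtain ⟨h1, U, ⟨d, d', h2⟩, h3⟩ := h
  obtain ⟨i, rfl⟩ := h3.exists_nat_pow_eq
  obtain ⟨e, e', h4⟩ := h2.rot_pow i
  exact ⟨h1.symm, _, ⟨e', e, h4.symm⟩,
    Equiv.Perm.sameCycle_pow_left.2 (Equiv.Perm.SameCycle.refl _ _)⟩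

theorem IsTriangulation.nonempty {n : ℕ} (hn : 4 ≤ n) {T : Finset (ℕ × ℕ)}
    (hT : IsTriangulation n T) : T.Nonempty := by
  by_contra h
  rw [Finset.not_nonempty_iff_eq_empty] at h
  have := hT.2 (0, 2) ⟨by simp, by simp only; omega, by simp only; omega⟩ (by simp [h])
  simp [h] at this

theorem rotTriangulation_ne {n : ℕ} (hn : 4 ≤ n) (T : Triangulation n) :
    rotTriangulation n T ≠ T := by
  intro h
  have := disjointTriangulations_self_rot T
  rw [h, DisjointTriangulations, disjoint_self] at this
  exact (T.2.nonempty hn).ne_empty this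

/-- Each step of a flip path from `V` to `U` is replaced by a rotation of `V` that makes it disjoint
from `U`, followed by a link. -/
theorem TriangulationLink.connected {n : ℕ} (hn : 5 ≤ n) (T T' : Triangulation n) :
    Relation.ReflTransGen
      (fun a b => (rotTriangulation n).SameCycle a b ∨ TriangulationLink a b) T T' := by
  have key : ∀ U, Relation.ReflTransGen (FlipAdj n) T.1 U → ∀ hU : IsTriangulation n U,
      Relation.ReflTransGen
        (fun a b => (rotTriangulation n).SameCycle a b ∨ TriangulationLink a b) T ⟨U, hU⟩ := by
    intro U h
    induction h with
    | refl => exact fun _ => Relation.ReflTransGen.refl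
    | @tail V U _ hVU ih =>
      intro hU
      obtain ⟨hV, -, d, d', hf⟩ := hVU
      obtain ⟨W, hW1, hW2⟩ : ∃ W : Triangulation n, DisjointTriangulations ⟨U, hU⟩ W ∧
          (rotTriangulation n).SameCycle ⟨V, hV⟩ W := by
        rcases IsFlip.disjoint_rot hn (T := ⟨V, hV⟩) (T' := ⟨U, hU⟩) hf with h | h
        · exact ⟨_, h, Equiv.Perm.sameCycle_apply_right.2 (Equiv.Perm.SameCycle.refl _ _)⟩
        · exact ⟨_, h, ⟨-1, by simp⟩⟩
      exact ((ih hV).tail (Or.inl hW2)).tail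
        (Or.inr (TriangulationLink.symm ⟨hW1, ⟨V, hV⟩, ⟨d', d, hf.symm⟩, hW2⟩))
  exact key T'.1 (T.2.reflTransGen_flipAdj T'.2) T'.2

open Classical in
/-- The result of the flip at the diagonal which has the short apex `0`, if there is one. -/
noncomputable def apexFlip {n : ℕ} (T : Triangulation n) : Triangulation n :=
  if h : ∃ U : Triangulation n, ∃ d d', IsShortApex n T.1 d 0 ∧ IsFlip T.1 U.1 d d'
  then h.choose else T

theorem apexFlip_eq {n : ℕ} {T U : Triangulation n} {d d' : ℕ × ℕ}
    (h : IsShortApex n T.1 d 0) (hf : IsFlip T.1 U.1 d d') : apexFlip T = U := by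
  have hex : ∃ U : Triangulation n, ∃ d d', IsShortApex n T.1 d 0 ∧ IsFlip T.1 U.1 d d' :=
    ⟨U, d, d', h, hf⟩
  rw [apexFlip, dif_pos hex]
  obtain ⟨e, e', h1, h2⟩ := hex.choose_spec
  rw [h1.unique_zero T.2 h] at h2
  exact Subtype.ext (h2.unique T.2 hex.choose.2 U.2 hf)

theorem apexFlip_eq_self {n : ℕ} {T : Triangulation n} (h : ∀ d, ¬ IsShortApex n T.1 d 0) :
    apexFlip T = T := by
  rw [apexFlip, dif_neg]
  rintro ⟨U, d, d', h1, -⟩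
  exact h d h1

/-- The triangulations of the `n`-gon can be arranged cyclically so that consecutive ones have no
common diagonal. -/
theorem exists_hamiltonian_triangulations {n : ℕ} (hn : 5 ≤ n) [Nonempty (Triangulation n)] :
    ∃ L : List (Triangulation n), L.Nodup ∧ (∀ T, T ∈ L) ∧
      IsCyclicChain DisjointTriangulations L := by
  have := Fintype.ofFinite (Triangulation n)
  have hinv : ∀ (T U : Triangulation n) (k : ℕ),
      (rotTriangulation n).SameCycle (((rotTriangulation n)⁻¹ ^ k) T) U ↔
        (rotTriangulation n).SameCycle T U := by
    intro T U k
    rw [← Equiv.Perm.sameCycle_inv, Equiv.Perm.sameCycle_pow_left, Equiv.Perm.sameCycle_inv]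
  refine exists_hamiltonian_list (r := rotTriangulation n) (link := TriangulationLink)
    (fun _ _ h => h.symm) (fun _ _ h => h.rot) disjointTriangulations_self_rot
    (rotTriangulation_ne (by omega)) (fun _ _ h => h.1) (fun _ _ h => h.rot) (fun _ _ h => h.symm)
    (orbitDegree_lt apexFlip ?_ ?_) (TriangulationLink.connected hn)
  · rintro T T' ⟨-, U, ⟨d, d', hf⟩, hU⟩
    obtain ⟨k, e, e', h1, h2⟩ := hf.exists_isShortApex_zero
    refine ⟨((rotTriangulation n)⁻¹ ^ k) T, ?_, ?_⟩
    · exact ((hinv _ _ k).2 (Equiv.Perm.SameCycle.refl _ _)).symm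
    · rw [apexFlip_eq h2 h1, hinv]
      exact hU
  · intro T
    obtain ⟨k, hk⟩ := exists_rot_not_isShortApex_zero (n := n) (by omega) T
    exact ⟨_, ((hinv _ _ k).2 (Equiv.Perm.SameCycle.refl _ _)).symm, apexFlip_eq_self hk⟩

/-! ### Counting triangulations by binary trees. -/

/-- The chords of a binary tree of triangles, whose leaves are the sides `(a, a + 1)`,
`(a + 1, a + 2)`, …. -/
def treeChords : BinaryTree Unit → ℕ → Finset (ℕ × ℕ)
  | .nil, _ => ∅
  | .node _ l r, a => insert (a, a + l.numNodes + r.numNodes + 2)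
      (treeChords l a ∪ treeChords r (a + l.numNodes + 1))

theorem bounds_of_mem_treeChords {t : BinaryTree Unit} {a p q : ℕ} (h : (p, q) ∈ treeChords t a) :
    a ≤ p ∧ p + 1 < q ∧ q ≤ a + t.numNodes + 1 := by
  induction t generalizing a with
  | nil => simp [treeChords] at h
  | node _ l r hl hr =>
    simp only [treeChords, Finset.mem_insert, Finset.mem_union, Prod.mk.injEq] at h
    simp only [BinaryTree.numNodes]
    rcases h with h | h | h
    · omega
    · have := hl h
      omega
    · have := hr h
      omega

theorem root_mem_treeChords {t : BinaryTree Unit} {a : ℕ} (h : 0 < t.numNodes) :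
    (a, a + t.numNodes + 1) ∈ treeChords t a := by
  cases t with
  | nil => simp at h
  | node _ l r =>
    simp only [treeChords, BinaryTree.numNodes]
    exact Finset.mem_insert.2 (Or.inl (Prod.ext rfl (by simp only; omega)))

theorem card_treeChords_le (t : BinaryTree Unit) (a : ℕ) :
    (treeChords t a).card ≤ t.numNodes := by
  induction t generalizing a with
  | nil => simp [treeChords]
  | node _ l r hl hr =>
    simp only [treeChords, BinaryTree.numNodes]
    refine (Finset.card_insert_le _ _).trans (Nat.succ_le_succ ?_)
    exact (Finset.card_union_le _ _).trans (Nat.add_le_add (hl _) (hr _))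

theorem treeChords_noncrossing {t : BinaryTree Unit} {a : ℕ} {d e : ℕ × ℕ}
    (hd : d ∈ treeChords t a) (he : e ∈ treeChords t a) : ¬ NatCrosses d e := by
  induction t generalizing a with
  | nil => simp [treeChords] at hd
  | node _ l r hl hr =>
    obtain ⟨p, q⟩ := d
    obtain ⟨p', q'⟩ := e
    have b1 := bounds_of_mem_treeChords hd
    have b2 := bounds_of_mem_treeChords he
    simp only [treeChords, Finset.mem_insert, Finset.mem_union, Prod.mk.injEq] at hd he
    simp only [BinaryTree.numNodes] at b1 b2
    rcases hd with hd | hd | hd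
    · simp only [NatCrosses]
      omega
    · rcases he with he | he | he
      · simp only [NatCrosses]
        omega
      · exact hl hd he
      · have := bounds_of_mem_treeChords hd
        have := bounds_of_mem_treeChords he
        simp only [NatCrosses]
        omega
    · rcases he with he | he | he
      · simp only [NatCrosses]
        omega
      · have := bounds_of_mem_treeChords hd
        have := bounds_of_mem_treeChords he
        simp only [NatCrosses]
        omega
      · exact hr hd he

/-- A pair on one side of the apex is handled by the corresponding subtree. A pair straddling the
apex avoids the roots of both subtrees only if it is the root chord itself. -/
theorem mem_treeChords_of_noncrossing {t : BinaryTree Unit} {a p q : ℕ} (h1 : a ≤ p)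
    (h2 : p + 1 < q) (h3 : q ≤ a + t.numNodes + 1)
    (h : ∀ d ∈ treeChords t a, ¬ NatCrosses d (p, q)) : (p, q) ∈ treeChords t a := by
  induction t generalizing a with
  | nil =>
    simp only [BinaryTree.numNodes] at h3
    omega
  | node _ l r hl hr =>
    simp only [treeChords, Finset.mem_insert, Finset.mem_union, BinaryTree.numNodes] at h h3 ⊢
    rcases le_or_gt q (a + l.numNodes + 1) with hq | hq
    · exact Or.inr (Or.inl (hl h1 hq fun d hd => h d (Or.inr (Or.inl hd))))
    rcases le_or_gt (a + l.numNodes + 1) p with hp | hp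
    · exact Or.inr (Or.inr (hr hp (by omega) fun d hd => h d (Or.inr (Or.inr hd))))
    left
    have hpa : p = a := by
      by_contra hne
      have := h _ (Or.inr (Or.inl (root_mem_treeChords (by omega))))
      simp only [NatCrosses] at this
      omega
    have hqb : q = a + l.numNodes + r.numNodes + 2 := by
      by_contra hne
      have := h _ (Or.inr (Or.inr (root_mem_treeChords (by omega))))
      simp only [NatCrosses] at this
      omega
    rw [hpa, hqb]

/-- The apex is determined by the chords: with a larger left subtree, its root would straddle the
apex of the other tree without being that tree's root chord. -/
theorem treeChords_injective {t t' : BinaryTree Unit} {a : ℕ} (hn : t.numNodes = t'.numNodes)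
    (h : treeChords t a = treeChords t' a) : t = t' := by
  induction t generalizing a t' with
  | nil =>
    cases t' with
    | nil => rfl
    | node _ l r => simp at hn
  | node _ l r hl hr =>
    cases t' with
    | nil => simp at hn
    | node _ l' r' =>
      simp only [BinaryTree.numNodes] at hn
      have split : ∀ {l r : BinaryTree Unit} {p q : ℕ},
          (p, q) ∈ treeChords (.node () l r) a →
            (p = a ∧ q = a + l.numNodes + r.numNodes + 2) ∨ q ≤ a + l.numNodes + 1 ∨
              a + l.numNodes + 1 ≤ p := by
        intro l r p q hpq
        simp only [treeChords, Finset.mem_insert, Finset.mem_union, Prod.mk.injEq] at hpq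
        rcases hpq with hpq | hpq | hpq
        · exact Or.inl hpq
        · exact Or.inr (Or.inl (bounds_of_mem_treeChords hpq).2.2)
        · exact Or.inr (Or.inr (bounds_of_mem_treeChords hpq).1)
      have hle : ∀ {l r l' r' : BinaryTree Unit},
          l.numNodes + r.numNodes + 1 = l'.numNodes + r'.numNodes + 1 →
          treeChords (.node () l r) a = treeChords (.node () l' r') a →
          l'.numNodes ≤ l.numNodes := by
        intro l r l' r' hn h
        by_contra hlt
        have hm : (a, a + l'.numNodes + 1) ∈ treeChords (.node () l r) a := by
          rw [h, treeChords]
          exact Finset.mem_insert_of_mem (Finset.mem_union_left _ (root_mem_treeChords (by omega)))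
        have := split hm
        omega
      have hll : l.numNodes = l'.numNodes := le_antisymm (hle hn.symm h.symm) (hle hn h)
      have hrr : r.numNodes = r'.numNodes := by omega
      have hL : treeChords l a = treeChords l' a := by
        have key : ∀ {l r l' r' : BinaryTree Unit}, l.numNodes = l'.numNodes →
            r.numNodes = r'.numNodes →
            treeChords (.node () l r) a = treeChords (.node () l' r') a →
            treeChords l a ⊆ treeChords l' a := by
          rintro l r l' r' hl hr h ⟨p, q⟩ hpq
          have b := bounds_of_mem_treeChords hpq
          have hm : (p, q) ∈ treeChords (.node () l' r') a := by
            rw [← h, treeChords]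
            exact Finset.mem_insert_of_mem (Finset.mem_union_left _ hpq)
          simp only [treeChords, Finset.mem_insert, Finset.mem_union, Prod.mk.injEq] at hm
          rcases hm with hm | hm | hm
          · omega
          · exact hm
          · have := bounds_of_mem_treeChords hm
            omega
        exact (key hll hrr h).antisymm (key hll.symm hrr.symm h.symm)
      have hR : treeChords r (a + l.numNodes + 1) = treeChords r' (a + l.numNodes + 1) := by
        have key : ∀ {l r l' r' : BinaryTree Unit}, l.numNodes = l'.numNodes →
            r.numNodes = r'.numNodes →
            treeChords (.node () l r) a = treeChords (.node () l' r') a →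
            treeChords r (a + l.numNodes + 1) ⊆ treeChords r' (a + l'.numNodes + 1) := by
          rintro l r l' r' hl hr h ⟨p, q⟩ hpq
          have b := bounds_of_mem_treeChords hpq
          have hm : (p, q) ∈ treeChords (.node () l' r') a := by
            rw [← h, treeChords]
            exact Finset.mem_insert_of_mem (Finset.mem_union_right _ hpq)
          simp only [treeChords, Finset.mem_insert, Finset.mem_union, Prod.mk.injEq] at hm
          rcases hm with hm | hm | hm
          · omega
          · have := bounds_of_mem_treeChords hm
            omega
          · exact hm
        have k1 := key hll hrr h
        have k2 := key hll.symm hrr.symm h.symm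
        rw [← hll] at k1 k2
        exact k1.antisymm k2
      rw [hl hll hL, hr hrr hR]

/-- The tree is built by splitting the chord at the apex of its inner triangle. -/
theorem IsTriangulation.exists_treeChords {n : ℕ} {T : Finset (ℕ × ℕ)} (hT : IsTriangulation n T)
    {i j : ℕ} (h : IsChord n T i j) :
    ∃ t : BinaryTree Unit, i + t.numNodes + 1 = j ∧
      ∀ p q, (p, q) ∈ treeChords t i ↔ p + 1 < q ∧ i ≤ p ∧ q ≤ j ∧ IsChord n T p q := by
  induction hk : j - i using Nat.strong_induction_on generalizing i j with
  | _ k ih =>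
    have hlt := hT.1.isChord_lt h
    by_cases hij : i + 1 < j
    · obtain ⟨m, h1, h2, h3, h4⟩ := hT.exists_apex h hij
      obtain ⟨l, hl1, hl2⟩ := ih (m - i) (by omega) h3 rfl
      obtain ⟨r, hr1, hr2⟩ := ih (j - m) (by omega) h4 rfl
      refine ⟨.node () l r, by simp only [BinaryTree.numNodes]; omega, fun p q => ?_⟩
      simp only [treeChords, Finset.mem_insert, Finset.mem_union, Prod.mk.injEq, hl1, hl2, hr2]
      constructor
      · rintro (⟨rfl, rfl⟩ | ⟨a1, a2, a3, a4⟩ | ⟨a1, a2, a3, a4⟩)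
        · have e : p + l.numNodes + r.numNodes + 2 = j := by omega
          rw [e]
          exact ⟨hij, le_refl _, le_refl _, h⟩
        · exact ⟨a1, a2, by omega, a4⟩
        · exact ⟨a1, by omega, a3, a4⟩
      · rintro ⟨a1, a2, a3, a4⟩
        rcases le_or_gt q m with hq | hq
        · exact Or.inr (Or.inl ⟨a1, a2, hq, a4⟩)
        rcases le_or_gt m p with hp | hp
        · exact Or.inr (Or.inr ⟨a1, hp, a3, a4⟩)
        have := hT.1.isChord_noncrossing h3 a4
        have := hT.1.isChord_noncrossing a4 h4
        exact Or.inl (by omega)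
    · refine ⟨.nil, by simp only [BinaryTree.numNodes]; omega, fun p q => ?_⟩
      simp only [treeChords, Finset.notMem_empty, false_iff]
      omega

theorem IsTriangulation.exists_tree {n : ℕ} (hn : 3 ≤ n) {T : Finset (ℕ × ℕ)}
    (hT : IsTriangulation n T) :
    ∃ t : BinaryTree Unit, t.numNodes = n - 2 ∧ (treeChords t 0).erase (0, n - 1) = T := by
  obtain ⟨t, h1, h2⟩ := hT.exists_treeChords (i := 0) (j := n - 1)
    (Or.inr (Or.inr ⟨rfl, by omega, by omega⟩))
  refine ⟨t, by omega, ?_⟩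
  ext ⟨p, q⟩
  simp only [Finset.mem_erase, ne_eq, Prod.mk.injEq, h2]
  constructor
  · rintro ⟨a1, a2, -, -, a3⟩
    exact IsDissection.mem_of_isChord a3 a2 (by omega)
  · intro h
    have := hT.1.1 _ h
    simp only [NatDiagonal] at this
    exact ⟨by omega, this.1, by omega, by omega, Or.inl h⟩

theorem IsTriangulation.card_le {n : ℕ} (hn : 3 ≤ n) {T : Finset (ℕ × ℕ)}
    (hT : IsTriangulation n T) : T.card ≤ n - 3 := by
  obtain ⟨t, h1, rfl⟩ := hT.exists_tree hn
  have h := root_mem_treeChords (t := t) (a := 0) (by omega)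
  rw [show 0 + t.numNodes + 1 = n - 1 by omega] at h
  rw [Finset.card_erase_of_mem h]
  have := card_treeChords_le t 0
  omega

theorem isTriangulation_treeChords {n : ℕ} (hn : 3 ≤ n) {t : BinaryTree Unit}
    (ht : t.numNodes = n - 2) : IsTriangulation n ((treeChords t 0).erase (0, n - 1)) := by
  refine ⟨⟨?_, ?_⟩, ?_⟩
  · rintro ⟨p, q⟩ hpq
    rw [Finset.mem_erase] at hpq
    have := bounds_of_mem_treeChords hpq.2
    have := hpq.1
    simp only [ne_eq, Prod.mk.injEq] at this
    simp only [NatDiagonal]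
    omega
  · exact fun d hd e he =>
      treeChords_noncrossing (Finset.mem_of_mem_erase hd) (Finset.mem_of_mem_erase he)
  · rintro ⟨p, q⟩ hpq hc
    simp only [NatDiagonal] at hpq
    refine Finset.mem_erase.2 ⟨by simp only [ne_eq, Prod.mk.injEq]; omega,
      mem_treeChords_of_noncrossing (Nat.zero_le _) hpq.1 (by omega) fun d hd => ?_⟩
    by_cases hd' : d = (0, n - 1)
    · rw [hd']
      simp only [NatCrosses]
      omega
    · exact hc d (Finset.mem_erase.2 ⟨hd', hd⟩)

/-- The number of triangulations of the `n`-gon is a Catalan number. -/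
theorem card_triangulation {n : ℕ} (hn : 3 ≤ n) : Nat.card (Triangulation n) = catalan (n - 2) := by
  have h1 : Nat.card {t : BinaryTree Unit // t.numNodes = n - 2} = catalan (n - 2) := by
    rw [← BinaryTree.treesOfNumNodesEq_card_eq_catalan,
      Nat.subtype_card _ fun t => BinaryTree.mem_treesOfNumNodesEq]
  rw [← h1]
  symm
  refine Nat.card_eq_of_bijective
    (fun t => ⟨(treeChords t.1 0).erase (0, n - 1), isTriangulation_treeChords hn t.2⟩) ⟨?_, ?_⟩
  · rintro ⟨t, ht⟩ ⟨t', ht'⟩ heq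
    have heq' := Subtype.ext_iff.1 heq
    simp only at heq'
    have hroot : ∀ t : BinaryTree Unit, t.numNodes = n - 2 → (0, n - 1) ∈ treeChords t 0 := by
      intro t ht
      have h := root_mem_treeChords (t := t) (a := 0) (by omega)
      rwa [show 0 + t.numNodes + 1 = n - 1 by omega] at h
    refine Subtype.ext (treeChords_injective (a := 0) (ht.trans ht'.symm) ?_)
    rw [← Finset.insert_erase (hroot t ht), heq', Finset.insert_erase (hroot t' ht')]
  · rintro ⟨T, hT⟩
    obtain ⟨t, h1, h2⟩ := hT.exists_tree hn
    exact ⟨⟨t, h1⟩, Subtype.ext h2⟩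

/-! ### Exposed points and supporting functionals. -/

section Polytope

variable {E : Type*} [NormedAddCommGroup E] [NormedSpace ℝ E]

theorem IsPolytope.isCompact {P : Set E} (hP : IsPolytope P) : IsCompact P := by
  obtain ⟨s, rfl⟩ := hP
  exact s.finite_toSet.isCompact_convexHull (𝕜 := ℝ)

theorem IsPolytope.convex {P : Set E} (hP : IsPolytope P) : Convex ℝ P := by
  obtain ⟨s, rfl⟩ := hP
  exact convex_convexHull ℝ _

/-- The extreme points of a polytope are exposed. -/
theorem IsPolytope.isExposed_singleton {P : Set E} (hP : IsPolytope P) {x : E}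
    (hx : x ∈ P.extremePoints ℝ) : IsExposed ℝ P {x} := by
  obtain ⟨s, hs⟩ := hP
  have hxs : ∀ y ∈ P.extremePoints ℝ, y ∈ s := fun y hy => by
    rw [hs] at hy
    exact extremePoints_convexHull_subset hy
  -- Removing an extreme point leaves a convex set, so `x` is outside the hull of the other
  -- generators and can be strictly separated from it.
  have hsub : convexHull ℝ ((s : Set E) \ {x}) ⊆ P \ {x} := by
    refine convexHull_min (Set.sdiff_subset_sdiff_left ?_)
      ((IsPolytope.convex ⟨s, hs⟩).mem_extremePoints_iff_convex_sdiff.1 hx).2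
    rw [hs]
    exact subset_convexHull ℝ _
  have hclosed : IsClosed (convexHull ℝ ((s : Set E) \ {x})) :=
    (s.finite_toSet.subset Set.sdiff_subset).isCompact_convexHull (𝕜 := ℝ) |>.isClosed
  obtain ⟨f, u, hf, hfu⟩ := geometric_hahn_banach_closed_point (convex_convexHull ℝ _) hclosed
    fun h => (hsub h).2 rfl
  have hlt : ∀ y ∈ s, y ≠ x → f y < f x := fun y hy hyx =>
    (hf y (subset_convexHull ℝ _ ⟨hy, hyx⟩)).trans hfu
  have hmax : ∀ y ∈ P, f y ≤ f x := by
    intro y hy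
    rw [hs] at hy
    refine convexHull_min (t := {z | f z ≤ f x}) (fun z hz => ?_)
      (convex_halfSpace_le f.isLinear _) hy
    by_cases hzx : z = x
    · rw [hzx]
      exact le_refl (f x)
    · exact (hlt z hz hzx).le
  intro _
  refine ⟨f, ?_⟩
  have hexp : IsExposed ℝ P {z ∈ P | ∀ y ∈ P, f y ≤ f z} := fun _ => ⟨f, rfl⟩
  set F := {z ∈ P | ∀ y ∈ P, f y ≤ f z} with hF
  have hxF : x ∈ F := ⟨hx.1, hmax⟩
  refine Set.Subset.antisymm (Set.singleton_subset_iff.2 hxF) ?_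
  have hFc : IsCompact F := hexp.isCompact (IsPolytope.isCompact ⟨s, hs⟩)
  rw [← closure_convexHull_extremePoints hFc (hexp.convex (IsPolytope.convex ⟨s, hs⟩))]
  -- Extreme points of the face are extreme in `P`, hence lie in `s`, where the separating
  -- functional peaks only at `x`. Krein–Milman then gives the whole face.
  have hext : F.extremePoints ℝ ⊆ {x} := by
    intro y hy
    by_contra hyx
    have h1 := hlt y (hxs y (hexp.isExtreme.extremePoints_subset_extremePoints hy)) hyx
    exact absurd (hy.1.2 x hx.1) (not_le.2 h1)
  exact closure_minimal (convexHull_min hext (convex_singleton x)) isClosed_singleton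

/-- Every nonempty exposed face of a compact set contains an extreme point of this set. -/
theorem IsExposed.exists_extremePoint {P F : Set E} (hP : IsCompact P) (hF : IsExposed ℝ P F)
    (hne : F.Nonempty) : ∃ x ∈ P.extremePoints ℝ, x ∈ F := by
  obtain ⟨x, hx⟩ := (hF.isCompact hP).extremePoints_nonempty hne
  exact ⟨x, hF.isExtreme.extremePoints_subset_extremePoints hx, hx.1⟩

/-- A point of a convex set outside of its relative interior has a nontrivial supporting
functional. -/
theorem Convex.exists_supporting [FiniteDimensional ℝ E] {P : Set E} (hP : Convex ℝ P) {z : E}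
    (hz : z ∈ P) (hzi : z ∉ intrinsicInterior ℝ P) :
    ∃ l : StrongDual ℝ E, (∀ y ∈ P, l y ≤ l z) ∧ ∃ y ∈ P, l y < l z := by
  set A := affineSpan ℝ P with hA
  have hzA : z ∈ A := subset_affineSpan ℝ P hz
  have : Nonempty A := ⟨⟨z, hzA⟩⟩
  -- Moving `z` to the origin of the direction space turns the relative interior into an ordinary
  -- one, so that Hahn–Banach applies.
  let e : A.direction ≃ₜ A := (AffineIsometryEquiv.vaddConst ℝ (⟨z, hzA⟩ : A)).toHomeomorph
  have he : ∀ v : A.direction, ((e v : A) : E) = (v : E) + z := fun v => rfl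
  set Q : Set A.direction := e ⁻¹' ((↑) ⁻¹' P) with hQ
  have hmem : ∀ v : A.direction, v ∈ Q ↔ (v : E) + z ∈ P := fun v => Iff.rfl
  have hint : interior Q = e ⁻¹' (interior ((↑) ⁻¹' P)) := (e.preimage_interior _).symm
  have hconv : Convex ℝ Q := by
    intro v hv w hw a b ha hb hab
    rw [hmem] at hv hw ⊢
    have := hP hv hw ha hb hab
    have e1 : a • ((v : E) + z) + b • ((w : E) + z) = a • (v : E) + b • (w : E) + (a + b) • z := by
      module
    rw [e1, hab, one_smul] at this
    exact this
  have hne : (interior Q).Nonempty := by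
    obtain ⟨_, ⟨y, hy, rfl⟩⟩ := Set.Nonempty.intrinsicInterior hP ⟨z, hz⟩
    exact ⟨e.symm y, by rw [hint, Set.mem_preimage, e.apply_symm_apply]; exact hy⟩
  have h0 : (0 : A.direction) ∉ interior Q := by
    intro h
    rw [hint] at h
    exact hzi ⟨e 0, h, by rw [he]; simp⟩
  obtain ⟨f, hf⟩ := geometric_hahn_banach_open_point hconv.interior isOpen_interior h0
  have hfQ : ∀ v ∈ Q, f v ≤ 0 := by
    have : closure (interior Q) ⊆ {v | f v ≤ 0} := by
      refine closure_minimal (fun v hv => ?_) (isClosed_le f.continuous continuous_const)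
      have := hf v hv
      rw [map_zero] at this
      exact this.le
    intro v hv
    refine this ?_
    rw [hconv.closure_interior_eq_closure_of_nonempty_interior hne]
    exact subset_closure hv
  obtain ⟨g₀, hg₀⟩ := f.toLinearMap.exists_extend
  let g : StrongDual ℝ E := g₀.toContinuousLinearMap
  have hg : ∀ v : A.direction, g v = f v := fun v => LinearMap.congr_fun hg₀ v
  refine ⟨g, fun y hy => ?_, ?_⟩
  · have hyd : y - z ∈ A.direction :=
      AffineSubspace.vsub_mem_direction (subset_affineSpan ℝ P hy) hzA
    have h1 := hfQ ⟨y - z, hyd⟩ (by rw [hmem]; simpa using hy)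
    rw [← hg] at h1
    simp only [map_sub] at h1
    linarith
  · obtain ⟨v, hv⟩ := hne
    have h1 := hf v hv
    rw [map_zero, ← hg] at h1
    refine ⟨(v : E) + z, (hmem v).1 (interior_subset hv), ?_⟩
    rw [map_add]
    linarith

end Polytope

/-! ### Faces of polyhedra given by inequalities. -/

section Polyhedron

variable {W ι : Type*} [NormedAddCommGroup W] [NormedSpace ℝ W]

/-- The polyhedron given by finitely many affine inequalities. -/
def polyhedron (l : ι → StrongDual ℝ W) (c : ι → ℝ) : Set W := {y | ∀ i, 0 ≤ l i y + c i}

variable {l : ι → StrongDual ℝ W} {c : ι → ℝ}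

theorem convex_polyhedron : Convex ℝ (polyhedron l c) := by
  intro x hx y hy a b ha hb hab i
  have h1 := mul_nonneg ha (hx i)
  have h2 := mul_nonneg hb (hy i)
  simp only [map_add, map_smul, smul_eq_mul]
  have : a * l i x + b * l i y + c i = a * (l i x + c i) + b * (l i y + c i) := by
    linear_combination (-(c i)) * hab
  linarith

/-- A sum of nonnegative slacks attains the value zero exactly where every slack vanishes. -/
theorem isExposed_polyhedron_face (D : Finset ι) :
    IsExposed ℝ (polyhedron l c) {y ∈ polyhedron l c | ∀ i ∈ D, l i y + c i = 0} := by
  rintro ⟨z, hz, hz0⟩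
  refine ⟨-∑ i ∈ D, l i, ?_⟩
  have hsum : ∀ y, (-∑ i ∈ D, l i) y = ∑ i ∈ D, c i - ∑ i ∈ D, (l i y + c i) := by
    intro y
    simp [Finset.sum_add_distrib]
  have hz1 : ∑ i ∈ D, (l i z + c i) = 0 := Finset.sum_eq_zero hz0
  ext y
  simp only [Set.mem_ofPred_eq, hsum]
  constructor
  · rintro ⟨hy, hy0⟩
    refine ⟨hy, fun w hw => ?_⟩
    rw [Finset.sum_eq_zero hy0]
    have := Finset.sum_nonneg fun i (_ : i ∈ D) => hw i
    linarith
  · rintro ⟨hy, hmax⟩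
    refine ⟨hy, ?_⟩
    have h1 := hmax z hz
    rw [hz1] at h1
    have h2 := Finset.sum_nonneg fun i (_ : i ∈ D) => hy i
    exact (Finset.sum_eq_zero_iff_of_nonneg fun i _ => hy i).1 (by linarith)

variable [Finite ι]

/-- A segment inside a polyhedron can be prolonged beyond an end which satisfies no more
equations than the other end. -/
theorem polyhedron_prolong {z y : W} (hz : z ∈ polyhedron l c)
    (h : ∀ i, l i z + c i = 0 → l i y + c i = 0) :
    ∃ ε : ℝ, 0 < ε ∧ z + ε • (z - y) ∈ polyhedron l c := by
  have hev : ∀ᶠ ε : ℝ in nhdsWithin 0 (Set.Ioi 0), ∀ i, 0 ≤ l i (z + ε • (z - y)) + c i := by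
    rw [Filter.eventually_all]
    intro i
    have hform : ∀ ε : ℝ, l i (z + ε • (z - y)) + c i =
        (l i z + c i) + ε * ((l i z + c i) - (l i y + c i)) := by
      intro ε
      simp only [map_add, map_smul, map_sub, smul_eq_mul]
      ring
    simp only [hform]
    rcases (hz i).eq_or_lt with h0 | h0
    · have h1 := h i h0.symm
      rw [← h0, h1]
      simp
    · have hcont : Continuous fun ε : ℝ => (l i z + c i) + ε * ((l i z + c i) - (l i y + c i)) := by
        fun_prop
      have ht := hcont.tendsto 0
      rw [zero_mul, add_zero] at ht
      exact ((ht.eventually (lt_mem_nhds h0)).filter_mono nhdsWithin_le_nhds).mono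
        fun ε hε => le_of_lt hε
  obtain ⟨ε, h1, h2⟩ := (hev.and self_mem_nhdsWithin).exists
  exact ⟨ε, h2, h1⟩

/-- A bounded polyhedron is a polytope. -/
theorem isPolytope_polyhedron (hc : IsCompact (polyhedron l c)) : IsPolytope (polyhedron l c) := by
  have hfin : ((polyhedron l c).extremePoints ℝ).Finite := by
    -- An extreme point is determined by its set of tight inequalities: a different point with the
    -- same set would allow prolonging the segment beyond it.
    refine Set.Finite.of_injOn (f := fun x => {i | l i x + c i = 0}) (t := Set.univ)
      (fun _ _ => Set.mem_univ _) ?_ Set.finite_univ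
    intro x hx y hy hxy
    by_contra hne
    obtain ⟨ε, hε, hmem⟩ := polyhedron_prolong (y := y) hx.1 fun i hi => by
      have : i ∈ {i | l i x + c i = 0} := hi
      simp only at hxy
      rw [hxy] at this
      exact this
    have hseg : x ∈ openSegment ℝ (x + ε • (x - y)) y := by
      have hpos : (0 : ℝ) < 1 + ε := by linarith
      refine ⟨1 / (1 + ε), ε / (1 + ε), by positivity, by positivity, by field_simp, ?_⟩
      have e1 : (1 / (1 + ε)) • (x + ε • (x - y)) + (ε / (1 + ε)) • y =
          ((1 + ε) / (1 + ε)) • x := by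
        module
      rw [e1, div_self hpos.ne', one_smul]
    exact hne ((mem_extremePoints.1 hx).2 _ hmem _ hy.1 hseg).2.symm
  refine ⟨hfin.toFinset, ?_⟩
  rw [Set.Finite.coe_toFinset]
  have h := closure_convexHull_extremePoints hc convex_polyhedron
  rw [(hfin.isCompact_convexHull (𝕜 := ℝ)).isClosed.closure_eq] at h
  exact h.symm

/-- An exposed face of a polyhedron is cut out by the equations which hold on it. -/
theorem IsExposed.eq_polyhedron_face {F : Set W} (hF : IsExposed ℝ (polyhedron l c) F)
    (hne : F.Nonempty) :
    F = {y ∈ polyhedron l c | ∀ i, (∀ z ∈ F, l i z + c i = 0) → l i y + c i = 0} := by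
  classical
  have hex : ∃ k : ℕ, ∃ z ∈ F, {i | l i z + c i = 0}.ncard = k := by
    obtain ⟨z, hz⟩ := hne
    exact ⟨_, z, hz, rfl⟩
  -- The point `z` has the fewest tight inequalities in `F`. A midpoint is tight only where both
  -- ends are, so those tight at `z` are tight on all of `F`.
  obtain ⟨z, hz, hzk⟩ := Nat.find_spec hex
  have hmin : ∀ y ∈ F, ∀ i, l i z + c i = 0 → l i y + c i = 0 := by
    intro y hy
    have hmid : (1 / 2 : ℝ) • z + (1 / 2 : ℝ) • y ∈ F :=
      hF.convex convex_polyhedron hz hy (by norm_num) (by norm_num) (by norm_num)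
    have hform : ∀ i, l i ((1 / 2 : ℝ) • z + (1 / 2 : ℝ) • y) + c i =
        ((l i z + c i) + (l i y + c i)) / 2 := by
      intro i
      simp only [map_add, map_smul, smul_eq_mul]
      ring
    have hsub : {i | l i ((1 / 2 : ℝ) • z + (1 / 2 : ℝ) • y) + c i = 0} ⊆
        {i | l i z + c i = 0} ∩ {i | l i y + c i = 0} := by
      intro i hi
      simp only [Set.mem_ofPred_eq, hform] at hi
      have h1 := hF.subset hz i
      have h2 := hF.subset hy i
      exact ⟨by simp only [Set.mem_ofPred_eq]; linarith, by simp only [Set.mem_ofPred_eq]; linarith⟩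
    have hle : {i | l i z + c i = 0}.ncard ≤
        {i | l i ((1 / 2 : ℝ) • z + (1 / 2 : ℝ) • y) + c i = 0}.ncard := by
      rw [hzk]
      exact Nat.find_min' hex ⟨_, hmid, rfl⟩
    have heq := Set.eq_of_subset_of_ncard_le (hsub.trans Set.inter_subset_left) hle
      (Set.toFinite _)
    intro i hi
    have : i ∈ {i | l i z + c i = 0} := hi
    rw [← heq] at this
    exact (hsub this).2
  obtain ⟨f, hf⟩ := hF hne
  ext y
  simp only [Set.mem_ofPred_eq]
  constructor
  · exact fun hy => ⟨hF.subset hy, fun i hi => hi y hy⟩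
  · rintro ⟨hy, hyF⟩
    -- The segment from `y` prolongs beyond `z`. As `f` is maximal at `z`, it cannot be smaller at
    -- `y`.
    obtain ⟨ε, hε, hmem⟩ := polyhedron_prolong (y := y) (hF.subset hz) fun i hi =>
      hyF i fun w hw => hmin w hw i hi
    rw [hf] at hz ⊢
    have h1 := hz.2 _ hmem
    simp only [map_add, map_smul, map_sub, smul_eq_mul] at h1
    have h2 : f z ≤ f y := by
      by_contra hlt
      have := mul_pos hε (sub_pos.2 (not_le.1 hlt))
      linarith
    exact ⟨hy, fun w hw => (hz.2 w hw).trans h2⟩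

theorem vectorSpan_polyhedron_eq_top {y : W} (hy : ∀ i, 0 < l i y + c i) :
    vectorSpan ℝ (polyhedron l c) = ⊤ := by
  have hev : ∀ᶠ x in nhds y, ∀ i, 0 < l i x + c i := by
    rw [Filter.eventually_all]
    intro i
    have hcont : Continuous fun x => l i x + c i := by fun_prop
    exact (hcont.tendsto y).eventually (lt_mem_nhds (hy i))
  have hint : (interior (polyhedron l c)).Nonempty :=
    ⟨y, mem_interior_iff_mem_nhds.2 (hev.mono fun x hx i => (hx i).le)⟩
  have := affineSpan_eq_top_of_nonempty_interior
    (hint.mono (interior_mono (subset_convexHull ℝ _)))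
  rw [← direction_affineSpan, this, AffineSubspace.direction_top]

end Polyhedron

/-! ### Dissections, refinement, and induction over crossings. -/

/-- The dissections of the `n`-gon, with vertices as natural numbers. -/
abbrev NatDissection (n : ℕ) : Type := {D : Finset (ℕ × ℕ) // IsDissection n D}

/-- Forgetting the bounds on the vertices. -/
def finPairEmbedding (n : ℕ) : Fin n × Fin n ↪ ℕ × ℕ :=
  Fin.valEmbedding.prodMap Fin.valEmbedding

theorem finPairEmbedding_apply {n : ℕ} (d : Fin n × Fin n) :
    finPairEmbedding n d = ((d.1 : ℕ), (d.2 : ℕ)) := rfl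

theorem natDiagonal_finPairEmbedding {n : ℕ} (d : Fin n × Fin n) :
    NatDiagonal n (finPairEmbedding n d) ↔ IsDiagonal d := by
  simp [finPairEmbedding_apply, NatDiagonal, IsDiagonal]

theorem natCrosses_finPairEmbedding {n : ℕ} (d e : Fin n × Fin n) :
    NatCrosses (finPairEmbedding n d) (finPairEmbedding n e) ↔ Crosses d e := Iff.rfl

theorem isDissection_map {n : ℕ} {D : Finset (Fin n × Fin n)} :
    IsDissection n (D.map (finPairEmbedding n)) ↔
      (∀ d ∈ D, IsDiagonal d) ∧ ∀ d ∈ D, ∀ e ∈ D, ¬ Crosses d e := by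
  simp only [IsDissection, Finset.forall_mem_map, natDiagonal_finPairEmbedding,
    natCrosses_finPairEmbedding]

/-- The dissections of the `n`-gon do not depend on the type of the vertices. -/
noncomputable def dissectionIso (n : ℕ) : Dissection n ≃o NatDissection n :=
  RelIso.ofSurjective
    (OrderEmbedding.ofMapLEIff
      (fun D : Dissection n =>
        (⟨D.1.map (finPairEmbedding n), isDissection_map.2 D.2⟩ : NatDissection n))
      fun _ _ => Finset.map_subset_map)
    (by
      rintro ⟨D, hD⟩
      have hmap : (D.preimage (finPairEmbedding n) (finPairEmbedding n).injective.injOn).map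
          (finPairEmbedding n) = D := by
        ext ⟨p, q⟩
        simp only [Finset.mem_map, Finset.mem_preimage]
        constructor
        · rintro ⟨d, hd, hd'⟩
          rwa [hd'] at hd
        · intro h
          have := hD.1 _ h
          simp only [NatDiagonal] at this
          exact ⟨(⟨p, by omega⟩, ⟨q, by omega⟩), h, rfl⟩
      exact ⟨⟨_, isDissection_map.1 (hmap.symm ▸ hD)⟩, Subtype.ext hmap⟩)

instance (n : ℕ) : Finite (NatDissection n) := Finite.of_equiv _ (dissectionIso n).toEquiv

/-- Every dissection can be refined to a triangulation. -/
theorem IsDissection.exists_triangulation {n : ℕ} {D : Finset (ℕ × ℕ)} (hD : IsDissection n D) :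
    ∃ T, IsTriangulation n T ∧ D ⊆ T := by
  obtain ⟨⟨T, hT⟩, hDT, hmax⟩ := Finite.exists_le_maximal (p := fun _ : NatDissection n => True)
    (a := ⟨D, hD⟩) trivial
  refine ⟨T, ⟨hT, fun e he hc => ?_⟩, hDT⟩
  have hins : IsDissection n (insert e T) := by
    refine ⟨Finset.forall_mem_insert _ _ _ |>.2 ⟨he, hT.1⟩, ?_⟩
    intro d hd f hf
    rcases Finset.mem_insert.1 hd with rfl | hd' <;> rcases Finset.mem_insert.1 hf with rfl | hf'
    · simp only [NatCrosses]
      omega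
    · exact fun h => hc f hf' h.symm
    · exact hc d hd'
    · exact hT.2 d hd' f hf'
  exact hmax.2 (y := ⟨insert e T, hins⟩) trivial (Finset.subset_insert _ _)
    (Finset.mem_insert_self _ _)

/-- Induction over the number of crossings with a triangulation. -/
theorem IsTriangulation.crossing_induction {n : ℕ} {T : Finset (ℕ × ℕ)} (hT : IsTriangulation n T)
    {P : ℕ → ℕ → Prop} (hchord : ∀ i j, IsChord n T i j → P i j)
    (hleft : ∀ a c b d, a < c → c < b → b < d → d < n → (a, b) ∈ T → ¬ IsChord n T c d →
      P a d → P c b → P c d)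
    (hright : ∀ a c b d, a < c → c < b → b < d → d < n → (c, d) ∈ T → ¬ IsChord n T a b →
      P a d → P c b → P a b) {i j : ℕ} (hij : i < j) (hj : j < n) : P i j := by
  classical
  induction hk : (T.filter fun d => NatCrosses d (i, j)).card using Nat.strong_induction_on
    generalizing i j with
  | _ k ih =>
    subst hk
    by_cases hc : IsChord n T i j
    · exact hchord i j hc
    have hex : ∃ p q, (p, q) ∈ T ∧ NatCrosses (p, q) (i, j) := by
      by_contra hcon
      push Not at hcon
      refine hc (hT.isChord_of_noncrossing hij hj fun p q hpq => ?_)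
      have := hcon p q hpq
      simp only [NatCrosses] at this
      omega
    obtain ⟨p, q, hpq, hcr⟩ := hex
    have hlt := hT.1.isChord_lt (Or.inl hpq)
    -- The two new pairs each share an endpoint with `(p, q)`. A diagonal of `T` crossing one of
    -- them also crosses `(i, j)`, while `(p, q)` itself no longer counts.
    have key : ∀ a b, (∀ d ∈ T, NatCrosses d (a, b) → NatCrosses d (i, j)) →
        ¬ NatCrosses (p, q) (a, b) → a < b → b < n → P a b := by
      intro a b hsub hnot hab hb
      refine ih _ (Finset.card_lt_card ?_) hab hb rfl
      rw [Finset.ssubset_iff_of_subset]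
      · exact ⟨(p, q), Finset.mem_filter.2 ⟨hpq, hcr⟩, fun h => hnot (Finset.mem_filter.1 h).2⟩
      · intro d hd
        rw [Finset.mem_filter] at hd ⊢
        exact ⟨hd.1, hsub d hd.1 hd.2⟩
    have hT2 := fun d hd => hT.1.2 d hd _ hpq
    simp only [NatCrosses] at hcr hT2 key
    rcases hcr with hcr | hcr
    · refine hleft p i q j hcr.1 hcr.2.1 hcr.2.2 hj hpq hc (key _ _ ?_ ?_ ?_ ?_)
        (key _ _ ?_ ?_ ?_ ?_)
      · intro d hd
        have := hT2 d hd
        omega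
      · omega
      · omega
      · omega
      · intro d hd
        have := hT2 d hd
        omega
      · omega
      · omega
      · omega
    · refine hright i p j q hcr.1 hcr.2.1 hcr.2.2 hlt.2 hpq hc (key _ _ ?_ ?_ ?_ ?_)
        (key _ _ ?_ ?_ ?_ ?_)
      · intro d hd
        have := hT2 d hd
        omega
      · omega
      · omega
      · omega
      · intro d hd
        have := hT2 d hd
        omega
      · omega
      · omega
      · omega

/-! ### Loday's realization of the associahedron. -/

/-- The slack of the inequality of the associahedron which belongs to the diagonal `(a, b)`, in terms
of the partial sums of the coordinates. -/
noncomputable def slack (s : ℕ → ℝ) (a b : ℕ) : ℝ :=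
  s (b - 1) - s a - ((b : ℝ) - a) * ((b : ℝ) - a - 1) / 2

/-- The partial sums cancel, and only the quadratic terms leave a remainder. For crossing pairs it
is at least 1, which drives both the positivity of slacks and the noncrossing of tight diagonals. -/
theorem slack_exchange (s : ℕ → ℝ) (a b c d : ℕ) :
    slack s a b + slack s c d = slack s a d + slack s c b + ((c : ℝ) - a) * ((d : ℝ) - b) := by
  unfold slack
  ring

theorem one_le_exchange {a b c d : ℕ} (h : a < c) (h' : b < d) :
    (1 : ℝ) ≤ ((c : ℝ) - a) * ((d : ℝ) - b) := by
  have h1 : (a : ℝ) + 1 ≤ c := by exact_mod_cast h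
  have h2 : (b : ℝ) + 1 ≤ d := by exact_mod_cast h'
  nlinarith

theorem slack_side (s : ℕ → ℝ) (i : ℕ) : slack s i (i + 1) = 0 := by
  unfold slack
  push_cast
  simp

/-- Small nonnegative slacks on a triangulation force positive slacks elsewhere. -/
theorem IsTriangulation.slack_pos {n : ℕ} {T : Finset (ℕ × ℕ)} (hT : IsTriangulation n T)
    {s : ℕ → ℝ} (hs : slack s 0 (n - 1) = 0)
    (h : ∀ d ∈ T, 0 ≤ slack s d.1 d.2 ∧ slack s d.1 d.2 ≤ 1 / 2) {i j : ℕ} (hij : i < j)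
    (hj : j < n) : 0 ≤ slack s i j ∧ (¬ IsChord n T i j → 0 < slack s i j) := by
  refine hT.crossing_induction (P := fun i j => 0 ≤ slack s i j ∧
    (¬ IsChord n T i j → 0 < slack s i j)) ?_ ?_ ?_ hij hj
  · intro i j hc
    refine ⟨?_, fun h => absurd hc h⟩
    rcases hc with hc | ⟨rfl, -⟩ | ⟨rfl, -, hj⟩
    · exact (h _ hc).1
    · exact (slack_side s i).ge
    · rw [show j = n - 1 by omega, hs]
  · intro a c b d h1 h2 h3 h4 h5 _ h6 h7
    have e := slack_exchange s a b c d
    have o := one_le_exchange h1 h3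
    have := (h _ h5).2
    simp only at this
    -- The remainder of at least 1 outweighs the slack of at most `1 / 2` on the crossing diagonal.
    have hp : 0 < slack s c d := by linarith [h6.1, h7.1]
    exact ⟨hp.le, fun _ => hp⟩
  · intro a c b d h1 h2 h3 h4 h5 _ h6 h7
    have e := slack_exchange s a b c d
    have o := one_le_exchange h1 h3
    have := (h _ h5).2
    simp only at this
    have hp : 0 < slack s a b := by linarith [h6.1, h7.1]
    exact ⟨hp.le, fun _ => hp⟩

section Realization

variable {n : ℕ}

/-- The linear functional which evaluates the `k`-th partial sum, up to a constant. -/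
noncomputable def partialSumDual (n k : ℕ) : StrongDual ℝ (EuclideanSpace ℝ (Fin (n - 3))) :=
  -- Coordinate `k - 1` is the `k`-th partial sum for `1 ≤ k ≤ n - 3`. The sums at 0 and at `n - 2`
  -- are constants, so their linear part is 0.
  if h : 1 ≤ k ∧ k - 1 < n - 3 then EuclideanSpace.proj ⟨k - 1, h.2⟩ else 0

/-- The constant term of the `k`-th partial sum. -/
noncomputable def partialSumConst (n k : ℕ) : ℝ :=
  if k = n - 2 then ((n : ℝ) - 1) * ((n : ℝ) - 2) / 2 else 0

/-- The partial sums of Loday's coordinates. -/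
noncomputable def partialSum (n : ℕ) (y : EuclideanSpace ℝ (Fin (n - 3))) (k : ℕ) : ℝ :=
  partialSumDual n k y + partialSumConst n k

/-- The diagonals of the `n`-gon. -/
abbrev NatDiagonals (n : ℕ) : Type := {d : ℕ × ℕ // NatDiagonal n d}

theorem finite_natDiagonal (n : ℕ) : {d : ℕ × ℕ | NatDiagonal n d}.Finite := by
  refine Set.Finite.subset (s := ((Finset.range n ×ˢ Finset.range n : Finset (ℕ × ℕ)) : Set _))
    (Finset.finite_toSet _) fun d hd => ?_
  have hd' : NatDiagonal n d := hd
  unfold NatDiagonal at hd'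
  simp only [Finset.coe_product, Set.mem_prod, Finset.mem_coe, Finset.mem_range]
  omega

instance (n : ℕ) : Finite (NatDiagonals n) := (finite_natDiagonal n).to_subtype

/-- The linear part of the inequality of a diagonal. -/
noncomputable def diagonalDual (n : ℕ) (d : NatDiagonals n) :
    StrongDual ℝ (EuclideanSpace ℝ (Fin (n - 3))) :=
  partialSumDual n (d.1.2 - 1) - partialSumDual n d.1.1

/-- The constant term of the inequality of a diagonal. -/
noncomputable def diagonalConst (n : ℕ) (d : NatDiagonals n) : ℝ :=
  partialSumConst n (d.1.2 - 1) - partialSumConst n d.1.1 -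
    ((d.1.2 : ℝ) - d.1.1) * ((d.1.2 : ℝ) - d.1.1 - 1) / 2

theorem diagonalDual_add_const (d : NatDiagonals n) (y : EuclideanSpace ℝ (Fin (n - 3))) :
    diagonalDual n d y + diagonalConst n d = slack (partialSum n y) d.1.1 d.1.2 := by
  simp only [diagonalDual, diagonalConst, slack, partialSum, sub_apply]
  ring

/-- Loday's associahedron. -/
def lodayPolytope (n : ℕ) : Set (EuclideanSpace ℝ (Fin (n - 3))) :=
  polyhedron (diagonalDual n) (diagonalConst n)

theorem mem_lodayPolytope {y : EuclideanSpace ℝ (Fin (n - 3))} :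
    y ∈ lodayPolytope n ↔ ∀ d, NatDiagonal n d → 0 ≤ slack (partialSum n y) d.1 d.2 := by
  simp only [lodayPolytope, polyhedron, diagonalDual_add_const, Subtype.forall]
  rfl

theorem partialSumDual_zero : partialSumDual n 0 = 0 := by simp [partialSumDual]

theorem partialSumDual_last : partialSumDual n (n - 2) = 0 := by
  rw [partialSumDual, dif_neg]
  omega

theorem slack_partialSum_root (hn : 3 ≤ n) (y : EuclideanSpace ℝ (Fin (n - 3))) :
    slack (partialSum n y) 0 (n - 1) = 0 := by
  have e : n - 1 - 1 = n - 2 := by omega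
  have e0 : ¬ (0 = n - 2) := by omega
  simp only [slack, partialSum, e, partialSumDual_zero, partialSumDual_last, partialSumConst, e0,
    if_true, if_false, zero_apply]
  rw [Nat.cast_sub (by omega)]
  push_cast
  ring

theorem slack_nonneg_of_mem (hn : 3 ≤ n) {y : EuclideanSpace ℝ (Fin (n - 3))}
    (hy : y ∈ lodayPolytope n) {a b : ℕ} (hab : a < b) (hb : b < n) :
    0 ≤ slack (partialSum n y) a b := by
  rw [mem_lodayPolytope] at hy
  by_cases h1 : b = a + 1
  · rw [h1, slack_side]
  by_cases h2 : a = 0 ∧ b + 1 = n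
  · rw [h2.1, show b = n - 1 by omega, slack_partialSum_root hn]
  · exact hy (a, b) ⟨by simp only; omega, hb, h2⟩

theorem coord_eq_partialSum (y : EuclideanSpace ℝ (Fin (n - 3))) (k : Fin (n - 3)) :
    y k = partialSum n y (k + 1) := by
  have hk := k.2
  rw [partialSum, partialSumDual, dif_pos ⟨by omega, by omega⟩, partialSumConst, if_neg (by omega)]
  simp

/-- The pairs `(0, k + 2)` and `(k + 1, n - 1)` bound the coordinate `k` from below and from above.
-/
theorem isCompact_lodayPolytope (hn : 3 ≤ n) : IsCompact (lodayPolytope n) := by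
  have hclosed : IsClosed (lodayPolytope n) := by
    have : lodayPolytope n = ⋂ d : NatDiagonals n,
        {y | 0 ≤ diagonalDual n d y + diagonalConst n d} := by
      ext y
      simp only [lodayPolytope, polyhedron, Set.mem_iInter]
      rfl
    rw [this]
    exact isClosed_iInter fun d => isClosed_le continuous_const (by fun_prop)
  set M : ℝ := ((n : ℝ) - 1) * ((n : ℝ) - 2) / 2 with hM
  have hK : IsCompact ((EuclideanSpace.equiv (Fin (n - 3)) ℝ).symm ''
      (Set.Icc (fun _ => 0) (fun _ => M))) :=
    isCompact_Icc.image (ContinuousLinearEquiv.continuous _)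
  refine hK.of_isClosed_subset hclosed fun y hy => ?_
  refine ⟨EuclideanSpace.equiv (Fin (n - 3)) ℝ y, ?_, ContinuousLinearEquiv.symm_apply_apply _ _⟩
  have hquad : ∀ m : ℝ, 1 ≤ m → 0 ≤ m * (m - 1) / 2 := fun m hm => by nlinarith
  have h0 : partialSum n y 0 = 0 := by
    rw [partialSum, partialSumDual_zero, partialSumConst, if_neg (by omega)]
    simp
  have hlast : partialSum n y (n - 2) = M := by
    rw [partialSum, partialSumDual_last, partialSumConst, if_pos rfl]
    simp [hM]
  refine ⟨fun k => ?_, fun k => ?_⟩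
  · change 0 ≤ y k
    have hk := k.2
    rw [coord_eq_partialSum]
    have h1 := slack_nonneg_of_mem hn hy (a := 0) (b := k + 2) (by omega) (by omega)
    unfold slack at h1
    rw [show (k : ℕ) + 2 - 1 = k + 1 by omega, h0] at h1
    have := hquad ((((k : ℕ) + 2 : ℕ) : ℝ) - ((0 : ℕ) : ℝ)) (by push_cast; linarith [(k : ℕ).cast_nonneg (α := ℝ)])
    linarith
  · change y k ≤ M
    have hk := k.2
    rw [coord_eq_partialSum]
    have h1 := slack_nonneg_of_mem hn hy (a := k + 1) (b := n - 1) (by omega) (by omega)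
    unfold slack at h1
    rw [show n - 1 - 1 = n - 2 by omega, hlast] at h1
    have := hquad (((n - 1 : ℕ) : ℝ) - (((k : ℕ) + 1 : ℕ) : ℝ)) (by
      have : (k : ℕ) + 1 + 1 ≤ n - 1 := by omega
      have : (((k : ℕ) + 1 : ℕ) : ℝ) + 1 ≤ ((n - 1 : ℕ) : ℝ) := by exact_mod_cast this
      linarith)
    linarith

/-- The slacks of the diagonals of a triangulation can be prescribed. -/
theorem IsTriangulation.exists_slack_eq (hn : 3 ≤ n) {T : Finset (ℕ × ℕ)}
    (hT : IsTriangulation n T) (w : ℕ × ℕ → ℝ) :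
    ∃ y : EuclideanSpace ℝ (Fin (n - 3)), ∀ d ∈ T, slack (partialSum n y) d.1 d.2 = w d := by
  let Ψ : EuclideanSpace ℝ (Fin (n - 3)) →ₗ[ℝ] (T → ℝ) :=
    LinearMap.pi fun d => (diagonalDual n ⟨d.1, hT.1.1 _ d.2⟩).toLinearMap
  have hΨ : ∀ y (d : T), Ψ y d =
      partialSumDual n (d.1.2 - 1) y - partialSumDual n d.1.1 y := fun y d => rfl
  have hinj : Function.Injective Ψ := by
    rw [injective_iff_map_eq_zero]
    intro y hy
    -- The linear parts satisfy the exchange identity without remainder, so vanishing on `T` spreads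
    -- to all pairs.
    have key : ∀ i j, i < j → j < n →
        partialSumDual n (j - 1) y - partialSumDual n i y = 0 := by
      intro i j hij hj
      refine hT.crossing_induction
        (P := fun i j => partialSumDual n (j - 1) y - partialSumDual n i y = 0) ?_ ?_ ?_ hij hj
      · rintro i j (hc | ⟨rfl, -⟩ | ⟨rfl, -, hj⟩)
        · rw [← hΨ y ⟨(i, j), hc⟩, hy]
          rfl
        · simp
        · rw [show j - 1 = n - 2 by omega, partialSumDual_last, partialSumDual_zero]
          simp
      · intro a c b d _ _ _ _ h5 _ h6 h7
        have := hΨ y ⟨(a, b), h5⟩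
        rw [hy] at this
        simp only [Pi.zero_apply] at this
        linarith
      · intro a c b d _ _ _ _ h5 _ h6 h7
        have := hΨ y ⟨(c, d), h5⟩
        rw [hy] at this
        simp only [Pi.zero_apply] at this
        linarith
    ext k
    have hk := k.2
    have := key 0 (k + 2) (by omega) (by omega)
    rw [partialSumDual_zero, show (k : ℕ) + 2 - 1 = k + 1 by omega] at this
    rw [coord_eq_partialSum, partialSum, partialSumConst, if_neg (by omega)]
    simpa using this
  have hle := LinearMap.finrank_le_finrank_of_injective hinj
  have hsurj : Function.Surjective Ψ := by
    -- Injectivity and the bound `T.card ≤ n - 3` force equal dimensions.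
    rw [← LinearMap.injective_iff_surjective_of_finrank_eq_finrank]
    · exact hinj
    · refine le_antisymm hle ?_
      simpa using hT.card_le hn
  obtain ⟨y, hy⟩ := hsurj fun d => w d.1 - diagonalConst n ⟨d.1, hT.1.1 _ d.2⟩
  refine ⟨y, fun d hd => ?_⟩
  have h1 := congrFun hy ⟨d, hd⟩
  have h2 : Ψ y ⟨d, hd⟩ = diagonalDual n ⟨d, hT.1.1 _ hd⟩ y := rfl
  have h3 := diagonalDual_add_const ⟨d, hT.1.1 _ hd⟩ y
  simp only at h1 h3
  rw [h2] at h1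
  linarith

/-- Every dissection is the set of tight inequalities of a point. -/
theorem IsDissection.exists_point (hn : 3 ≤ n) {D : Finset (ℕ × ℕ)} (hD : IsDissection n D) :
    ∃ y ∈ lodayPolytope n, ∀ d, NatDiagonal n d →
      (slack (partialSum n y) d.1 d.2 = 0 ↔ d ∈ D) := by
  classical
  obtain ⟨T, hT, hDT⟩ := hD.exists_triangulation
  -- The value `1 / 2` is positive and still within the bound of `IsTriangulation.slack_pos`.
  obtain ⟨y, hy⟩ := hT.exists_slack_eq hn fun d => if d ∈ D then 0 else 1 / 2
  have hpos := fun d (hd : NatDiagonal n d) =>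
    hT.slack_pos (slack_partialSum_root hn y) (fun e he => by
      rw [hy e he]
      split_ifs <;> norm_num) (i := d.1) (j := d.2) (by unfold NatDiagonal at hd; omega) hd.2.1
  refine ⟨y, mem_lodayPolytope.2 fun d hd => (hpos d hd).1, fun d hd => ?_⟩
  by_cases hdT : d ∈ T
  · rw [hy d hdT]
    split_ifs with h
    · simp [h]
    · norm_num [h]
  · refine ⟨fun h0 => ?_, fun h => absurd (hDT h) hdT⟩
    refine absurd h0 ((hpos d hd).2 fun hc => hdT ?_).ne'
    exact IsDissection.mem_of_isChord hc hd.1 hd.2.2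

/-- The face of the associahedron which belongs to a dissection. -/
def lodayFace (hn : 3 ≤ n) (D : NatDissection n) : Face (lodayPolytope n) :=
  ⟨{y ∈ lodayPolytope n | ∀ d ∈ D.1, slack (partialSum n y) d.1 d.2 = 0}, by
    obtain ⟨y, hy, hyD⟩ := D.2.exists_point hn
    exact ⟨y, hy, fun d hd => (hyD d (D.2.1 d hd)).2 hd⟩, by
    classical
    have h := isExposed_polyhedron_face (l := diagonalDual n) (c := diagonalConst n)
      (D.1.subtype (NatDiagonal n))
    refine Eq.mpr (congrArg (IsExposed ℝ (lodayPolytope n)) ?_) h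
    ext y
    constructor
    · rintro ⟨hy, hD⟩
      refine ⟨hy, fun d hd => ?_⟩
      rw [diagonalDual_add_const]
      exact hD d.1 (Finset.mem_subtype.1 hd)
    · rintro ⟨hy, hD⟩
      refine ⟨hy, fun d hd => ?_⟩
      rw [← diagonalDual_add_const ⟨d, D.2.1 d hd⟩]
      exact hD _ (Finset.mem_subtype.2 hd)⟩

/-- If crossing diagonals were both tight, the exchange identity would equate 0 with two nonnegative
slacks plus at least 1. -/
theorem isDissection_of_tight (hn : 3 ≤ n) {y : EuclideanSpace ℝ (Fin (n - 3))}
    (hy : y ∈ lodayPolytope n) {D : Finset (ℕ × ℕ)} (hD : ∀ d ∈ D, NatDiagonal n d)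
    (h : ∀ d ∈ D, slack (partialSum n y) d.1 d.2 = 0) : IsDissection n D := by
  have key : ∀ d ∈ D, ∀ e ∈ D, ¬ (d.1 < e.1 ∧ e.1 < d.2 ∧ d.2 < e.2) := by
    rintro d hd e he ⟨h1, h2, h3⟩
    have hx := slack_exchange (partialSum n y) d.1 d.2 e.1 e.2
    have ho := one_le_exchange h1 h3
    have hb := (hD e he).2.1
    have n1 := slack_nonneg_of_mem hn hy (a := d.1) (b := e.2) (by omega) hb
    have n2 := slack_nonneg_of_mem hn hy (a := e.1) (b := d.2) h2 (by omega)
    rw [h d hd, h e he] at hx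
    linarith
  exact ⟨hD, fun d hd e he hc => hc.elim (key d hd e he) (key e he d hd)⟩

/-- The faces of Loday's associahedron correspond to the dissections. -/
noncomputable def lodayFaceIso (hn : 3 ≤ n) : (NatDissection n)ᵒᵈ ≃o Face (lodayPolytope n) :=
  RelIso.ofSurjective
    (OrderEmbedding.ofMapLEIff (fun D => lodayFace hn (OrderDual.ofDual D)) (by
      intro D D'
      constructor
      · intro h d hd
        obtain ⟨y, hy, hyD⟩ := (OrderDual.ofDual D).2.exists_point hn
        have hd' := (OrderDual.ofDual D').2.1 d hd
        have hmem : y ∈ (lodayFace hn (OrderDual.ofDual D)).1 :=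
          ⟨hy, fun e he => (hyD e ((OrderDual.ofDual D).2.1 e he)).2 he⟩
        exact (hyD d hd').1 ((h hmem).2 d hd)
      · intro h y hy
        exact ⟨hy.1, fun d hd => hy.2 d (h hd)⟩))
    (by
      rintro ⟨F, hne, hF⟩
      have hfin : {d : ℕ × ℕ | NatDiagonal n d ∧
          ∀ z ∈ F, slack (partialSum n z) d.1 d.2 = 0}.Finite :=
        (finite_natDiagonal n).subset fun d hd => hd.1
      obtain ⟨z, hz⟩ := hne
      have hD : IsDissection n hfin.toFinset :=
        isDissection_of_tight hn (hF.subset hz) (fun d hd => (hfin.mem_toFinset.1 hd).1)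
          fun d hd => (hfin.mem_toFinset.1 hd).2 z hz
      refine ⟨OrderDual.toDual ⟨_, hD⟩, Subtype.ext ?_⟩
      change {y ∈ lodayPolytope n | ∀ d ∈ hfin.toFinset, slack (partialSum n y) d.1 d.2 = 0} = F
      refine Eq.trans ?_ (IsExposed.eq_polyhedron_face hF ⟨z, hz⟩).symm
      ext y
      simp [diagonalDual_add_const, lodayPolytope, and_imp])

theorem isAssociahedron_lodayPolytope (hn : 3 ≤ n) : IsAssociahedron n (lodayPolytope n) where
  isPolytope := isPolytope_polyhedron (isCompact_lodayPolytope hn)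
  finrank_vectorSpan := by
    -- The empty dissection yields a point with all slacks positive, so the polytope is
    -- full-dimensional.
    have hempty : IsDissection n ∅ := by simp [IsDissection]
    obtain ⟨y, hy, hyD⟩ := hempty.exists_point hn
    rw [lodayPolytope, vectorSpan_polyhedron_eq_top (y := y), finrank_top, finrank_euclideanSpace,
      Fintype.card_fin]
    · omega
    · intro d
      rw [diagonalDual_add_const]
      refine lt_of_le_of_ne (mem_lodayPolytope.1 hy d.1 d.2) fun h => ?_
      simpa using (hyD d.1 d.2).1 h.symm
  faceIso := ⟨(lodayFaceIso hn).symm.trans (dissectionIso n).symm.dual⟩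

end Realization

/-! ### From disjoint triangulations to segments in an arbitrary realization. -/

theorem IsCyclicChain.rel_getElem {X : Type*} {R : X → X → Prop} {L : List X}
    (h : IsCyclicChain R L) {k : ℕ} (hk : k < L.length) :
    R L[k] (L[(k + 1) % L.length]'(Nat.mod_lt _ (by omega))) := by
  by_cases hk1 : k + 1 < L.length
  · have := List.isChain_iff_getElem.1 h.1 k hk1
    simpa only [Nat.mod_eq_of_lt hk1] using this
  · have he : k + 1 = L.length := by omega
    simp only [he, Nat.mod_self]
    refine h.2 _ ?_ _ ?_
    · rw [List.getLast?_eq_getElem?, ← he, Nat.add_sub_cancel, List.getElem?_eq_getElem hk]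
      rfl
    · rw [List.head?_eq_getElem?, List.getElem?_eq_getElem (by omega)]
      rfl

section Realized

variable {E : Type*} [NormedAddCommGroup E] [NormedSpace ℝ E] {n : ℕ} {P : Set E}

/-- The face of a triangulation is a vertex. -/
theorem IsPolytope.exists_vertex (hP : IsPolytope P) (φ : Face P ≃o (NatDissection n)ᵒᵈ)
    (T : Triangulation n) :
    ∃ x ∈ P.extremePoints ℝ, (φ.symm (OrderDual.toDual ⟨T.1, T.2.1⟩)).1 = {x} := by
  set F := φ.symm (OrderDual.toDual ⟨T.1, T.2.1⟩) with hF
  obtain ⟨x, hx, hxF⟩ := F.2.2.exists_extremePoint hP.isCompact F.2.1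
  refine ⟨x, hx, ?_⟩
  let G : Face P := ⟨{x}, Set.singleton_nonempty x, hP.isExposed_singleton hx⟩
  have hGF : G ≤ F := Set.singleton_subset_iff.2 hxF
  have h1 : φ G ≤ OrderDual.toDual ⟨T.1, T.2.1⟩ := by
    rw [← φ.apply_symm_apply (OrderDual.toDual _), ← hF]
    exact φ.monotone hGF
  have h2 : T.1 ⊆ (OrderDual.ofDual (φ G)).1 := h1
  -- The smaller face `{x}` has a dissection containing `T`, and a triangulation is maximal.
  have h3 : (OrderDual.ofDual (φ G)).1 = T.1 := by
    refine Finset.Subset.antisymm (fun d hd => ?_) h2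
    exact T.2.2 d ((OrderDual.ofDual (φ G)).2.1 d hd) fun e he =>
      (OrderDual.ofDual (φ G)).2.2 e (h2 he) d hd
  have h4 : φ G = OrderDual.toDual ⟨T.1, T.2.1⟩ := congrArg OrderDual.toDual (Subtype.ext h3)
  rw [hF, ← h4, φ.symm_apply_apply]

theorem mem_face_iff (φ : Face P ≃o (NatDissection n)ᵒᵈ) {T : Triangulation n} {x : E}
    (hx : (φ.symm (OrderDual.toDual ⟨T.1, T.2.1⟩)).1 = {x}) (F : Face P) :
    x ∈ F.1 ↔ (OrderDual.ofDual (φ F)).1 ⊆ T.1 := by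
  rw [← Set.singleton_subset_iff, ← hx]
  change φ.symm (OrderDual.toDual ⟨T.1, T.2.1⟩) ≤ F ↔ _
  rw [φ.symm_apply_le]
  rfl

/-- Vertices which belong to disjoint triangulations see each other through the interior. -/
theorem openSegment_subset_intrinsicInterior_of_disjoint [FiniteDimensional ℝ E]
    (hP : IsPolytope P) (φ : Face P ≃o (NatDissection n)ᵒᵈ) {T T' : Triangulation n} {x x' : E}
    (hx : (φ.symm (OrderDual.toDual ⟨T.1, T.2.1⟩)).1 = {x})
    (hx' : (φ.symm (OrderDual.toDual ⟨T'.1, T'.2.1⟩)).1 = {x'})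
    (hdisj : DisjointTriangulations T T') : openSegment ℝ x x' ⊆ intrinsicInterior ℝ P := by
  intro z hz
  have hxP : x ∈ P := (φ.symm (OrderDual.toDual ⟨T.1, T.2.1⟩)).2.2.subset (hx ▸ rfl)
  have hxP' : x' ∈ P := (φ.symm (OrderDual.toDual ⟨T'.1, T'.2.1⟩)).2.2.subset (hx' ▸ rfl)
  have hzP : z ∈ P := hP.convex.openSegment_subset hxP hxP' hz
  by_contra hzi
  obtain ⟨l, hl, y, hy, hyz⟩ := hP.convex.exists_supporting hzP hzi
  obtain ⟨a, b, ha, hb, hab, rfl⟩ := hz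
  have h1 := hl x hxP
  have h2 := hl x' hxP'
  simp only [map_add, map_smul, smul_eq_mul] at h1 h2 hl hyz
  obtain rfl : b = 1 - a := by linarith
  have h3 : l x = a * l x + (1 - a) * l x' := by
    refine le_antisymm h1 ?_
    nlinarith
  have h4 : l x' = a * l x + (1 - a) * l x' := by
    refine le_antisymm h2 ?_
    nlinarith
  -- The functional attains its maximum inside the segment, hence at both ends, so `F` contains both
  -- vertices. Its dissection lies in `T ∩ T' = ∅`, which forces `F = P` although the functional is
  -- not constant on `P`.
  let F : Face P := ⟨{w ∈ P | ∀ y ∈ P, l y ≤ l w},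
    ⟨x, hxP, fun y hy => (hl y hy).trans h3.ge⟩, fun _ => ⟨l, rfl⟩⟩
  have hxF : x ∈ F.1 := ⟨hxP, fun y hy => (hl y hy).trans h3.ge⟩
  have hxF' : x' ∈ F.1 := ⟨hxP', fun y hy => (hl y hy).trans h4.ge⟩
  rw [mem_face_iff φ hx] at hxF
  rw [mem_face_iff φ hx'] at hxF'
  have hempty : (OrderDual.ofDual (φ F)).1 = ∅ := by
    rw [← Finset.subset_empty]
    exact hdisj hxF hxF'
  let top : Face P := ⟨P, ⟨x, hxP⟩, IsExposed.refl P⟩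
  have hle : top ≤ F := by
    rw [← φ.le_iff_le]
    change (OrderDual.ofDual (φ F)).1 ⊆ (OrderDual.ofDual (φ top)).1
    rw [hempty]
    exact Finset.empty_subset _
  have hyF : y ∈ F.1 := hle hy
  have := hyF.2 x hxP
  linarith

end Realized

/-- The associahedron exists as a polytope in `ℝ^(n-3)`, and in every realization of it the
vertices can be enumerated cyclically so that the open segment between consecutive vertices lies in
the (relative) interior. -/
theorem corollary2 (n : ℕ) (hn : 5 ≤ n) :
    (∃ P : Set (EuclideanSpace ℝ (Fin (n - 3))), IsAssociahedron n P) ∧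
    ∀ (E : Type*) [NormedAddCommGroup E] [NormedSpace ℝ E] [FiniteDimensional ℝ E] (P : Set E),
      IsAssociahedron n P →
        ∃ v : ZMod (catalan (n - 2)) → E,
          Function.Injective v ∧ Set.range v = P.extremePoints ℝ ∧
          ∀ i, openSegment ℝ (v i) (v (i + 1)) ⊆ intrinsicInterior ℝ P := by
  refine ⟨⟨_, isAssociahedron_lodayPolytope (by omega)⟩, ?_⟩
  intro E _ _ _ P hP
  obtain ⟨φ₀⟩ := hP.faceIso
  let φ : Face P ≃o (NatDissection n)ᵒᵈ := φ₀.trans (dissectionIso n).dual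
  choose v hv hvF using hP.isPolytope.exists_vertex φ
  have hempty : IsDissection n ∅ := by simp [IsDissection]
  obtain ⟨T₀, hT₀, -⟩ := hempty.exists_triangulation
  have : Nonempty (Triangulation n) := ⟨⟨T₀, hT₀⟩⟩
  obtain ⟨L, hnd, hmem, hchain⟩ := exists_hamiltonian_triangulations hn
  have hlen : L.length = catalan (n - 2) := by
    classical
    have := Fintype.ofFinite (Triangulation n)
    rw [← card_triangulation (n := n) (by omega), Nat.card_eq_fintype_card,
      ← List.toFinset_card_of_nodup hnd, Finset.eq_univ_of_forall fun T => List.mem_toFinset.2 (hmem T),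
      Finset.card_univ]
  have hinj : Function.Injective v := by
    intro T T' h
    have h1 : (φ.symm (OrderDual.toDual ⟨T.1, T.2.1⟩)).1 =
        (φ.symm (OrderDual.toDual ⟨T'.1, T'.2.1⟩)).1 := by rw [hvF, hvF, h]
    have h2 := φ.symm.injective (Subtype.ext h1)
    exact Subtype.ext (congrArg (fun D => (OrderDual.ofDual D).1) h2)
  have hpos : 0 < catalan (n - 2) := by
    rw [← hlen]
    exact List.length_pos_of_mem (hmem ⟨T₀, hT₀⟩)
  rw [← hlen] at hpos ⊢
  have : NeZero L.length := ⟨hpos.ne'⟩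
  refine ⟨fun i => v (L[i.val]'(ZMod.val_lt i)), ?_, ?_, ?_⟩
  · intro i j hij
    exact ZMod.val_injective _ ((hnd.getElem_inj_iff).1 (hinj hij))
  · refine Set.Subset.antisymm (Set.range_subset_iff.2 fun i => hv _) fun x hx => ?_
    let G : Face P := ⟨{x}, Set.singleton_nonempty x, hP.isPolytope.isExposed_singleton hx⟩
    -- The vertex of any triangulation refining the dissection of `{x}` lies in `{x}`, so every
    -- extreme point is reached.
    obtain ⟨T, hT, hDT⟩ := (OrderDual.ofDual (φ G)).2.exists_triangulation
    have hvT : v ⟨T, hT⟩ ∈ G.1 := (mem_face_iff φ (hvF ⟨T, hT⟩) G).2 hDT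
    obtain ⟨k, hk, hkT⟩ := List.getElem_of_mem (hmem ⟨T, hT⟩)
    refine ⟨(k : ZMod L.length), ?_⟩
    simp only [ZMod.val_cast_of_lt hk, hkT]
    exact hvT
  · intro i
    have hval : (i + 1).val = (i.val + 1) % L.length := by
      rw [ZMod.val_add, ZMod.val_one_eq_one_mod, Nat.add_mod_mod]
    have h := hchain.rel_getElem (ZMod.val_lt i)
    simp only [hval]
    exact openSegment_subset_intrinsicInterior_of_disjoint hP.isPolytope φ (hvF _) (hvF _) h
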